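/- Theorem 1.1. For all integers $d,s\ge 1$ there is a number $B(d,s)$, depending only on $d$ and $s$, such that the following holds. Let $k$ be an algebraically closed field of characteristic $0$, let $K=k(t)$, and let $S$ be a finite set of $s$ places of $K$ (the places are the valuations $v_\alpha$ attached to $t-\alpha$, $\alpha\in k$, and the valuation $v_\infty$ attached to $1/t$). Let $\varphi\in K(z)$ be a rational function of degree $d$, viewed as an endomorphism of $\mathbb P^1$ over $K$, such that - $\varphi$ is not isotrivial over $K$, i.e. there is no $A\in \mathrm{PGL}_2(K)$ for which $A\circ\varphi\circ A^{-1}$ is defined over $k$; - $\varphi$ is not of finite order, i.e. no iterate $\varphi^n$ with $n\ge 1$ is the identity (this is automatic if $d\ge 2$); - $\varphi$ has good reduction at every place $\mathfrak p\notin S$, i.e. for each such $\mathfrak p$ there is $A\in\mathrm{PGL}_2(K)$ such that $A\circ\varphi\circ A^{-1}$ can be written as $F(z)/G(z)$ with polynomials $F,G$ of degree at most $d$ whose coefficients are $\mathfrak p$-integral and not all in the maximal ideal at $\mathfrak p$, and for which the resultant of the degree $d$ homogenizations of $F$ and $G$ is a $\mathfrak p$-adic unit. Then the set $\mathrm{PrePer}(\varphi,K)$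 of points $P\in\mathbb P^1(K)$ with $\varphi^{n+m}(P)=\varphi^m(P)$ for some $n\ge 1$, $m\ge 0$ is finite and $$\#\mathrm{PrePer}(\varphi,K)\le B(d,s).$$ -/

import Mathlib

/-! Endomorphisms of the projective line over `K = k(t)`, where `k(t)` is `RatFunc k` and a rational
function `φ ∈ K(z)` is an element of `RatFunc K`. The projective line `ℙ¹(K) = K ∪ {∞}` is
`OnePoint K`, on which `GL (Fin 2) K` acts by Möbius transformations. -/

noncomputable section

namespace ProjLineDyn

open Polynomial

section Maps

variable {K : Type*} [Field K]

/-- The degree of a rational function: the maximum of the degrees of numerator and denominator in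
lowest terms. -/
def mapDegree (φ : RatFunc K) : ℕ := max φ.num.natDegree φ.denom.natDegree

open Classical in
/-- The self-map of `ℙ¹(K) = K ∪ {∞}` given by `φ = f / g` (in lowest terms, of degree `d`): it is
`[x : y] ↦ [F(x, y) : G(x, y)]` with `F`, `G` the degree `d` homogenizations of `f`, `g`. At
`∞ = [1 : 0]` the values of `F`, `G` are the coefficients of `z ^ d` in `f`, `g`. -/
def toMap (φ : RatFunc K) (P : OnePoint K) : OnePoint K :=
  P.elim
    (if φ.denom.coeff (mapDegree φ) = 0 then OnePoint.infty
      else ((φ.num.coeff (mapDegree φ) / φ.denom.coeff (mapDegree φ) : K) : OnePoint K))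
    (fun x => if φ.denom.eval x = 0 then OnePoint.infty
      else ((φ.num.eval x / φ.denom.eval x : K) : OnePoint K))

/-- Over an infinite field a rational function is determined by its self-map of `ℙ¹(K)`, so that
identities between endomorphisms of `ℙ¹` may be stated through these self-maps. -/
theorem toMap_injective [Infinite K] : Function.Injective (toMap (K := K)) := by
  classical
  intro φ ψ h
  have hpoly : φ.num * ψ.denom = ψ.num * φ.denom := by
    have hz : (φ.denom * ψ.denom) * (φ.num * ψ.denom - ψ.num * φ.denom) = 0 := by
      apply Polynomial.funext
      intro x
      have hx := congrFun h (x : OnePoint K)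
      simp only [toMap, OnePoint.elim_some] at hx
      by_cases h1 : φ.denom.eval x = 0
      · simp [h1]
      · by_cases h2 : ψ.denom.eval x = 0
        · simp [h2]
        · rw [if_neg h1, if_neg h2, OnePoint.coe_eq_coe, div_eq_div_iff h1 h2] at hx
          simp [hx]
    rcases mul_eq_zero.1 hz with h0 | h0
    · exact absurd h0 (mul_ne_zero φ.denom_ne_zero ψ.denom_ne_zero)
    · exact sub_eq_zero.1 h0
  rw [← RatFunc.num_div_denom φ, ← RatFunc.num_div_denom ψ,
    div_eq_div_iff (RatFunc.algebraMap_ne_zero φ.denom_ne_zero)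
      (RatFunc.algebraMap_ne_zero ψ.denom_ne_zero), ← map_mul, ← map_mul, hpoly]

/-- The set `PrePer(φ, K)` of preperiodic points of `φ` in `ℙ¹(K)`. -/
def prePer (φ : RatFunc K) : Set (OnePoint K) :=
  {P | ∃ n m : ℕ, 0 < n ∧ (toMap φ)^[n + m] P = (toMap φ)^[m] P}

/-- `φ` has finite order: some iterate `φ ^ n`, `n ≥ 1`, is the identity of `ℙ¹`
(`K` is to be infinite). -/
def HasFiniteOrder (φ : RatFunc K) : Prop := ∃ n : ℕ, 0 < n ∧ (toMap φ)^[n] = id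

open Classical in
/-- `ψ = A ∘ φ ∘ A⁻¹` as endomorphisms of `ℙ¹` (`K` is to be infinite). The automorphism of `ℙ¹` is
the class in `PGL₂(K)` of the matrix `A`. -/
def IsConjBy (A : GL (Fin 2) K) (φ ψ : RatFunc K) : Prop :=
  ∀ P : OnePoint K, toMap ψ P = A • toMap φ (A⁻¹ • P)

end Maps

section FunctionField

variable {k : Type*} [Field k]

/-- The maximal ideal `(t - α)` of `k[t]`. -/
def linearPrime (α : k) : IsDedekindDomain.HeightOneSpectrum k[X] where
  asIdeal := Ideal.span {X - C α}
  isPrime := (Ideal.span_singleton_prime (X_sub_C_ne_zero α)).2 (prime_X_sub_C α)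
  ne_bot := by
    rw [ne_eq, Ideal.span_singleton_eq_bot]
    exact X_sub_C_ne_zero α

open Classical in
/-- For `k` algebraically closed the places of `k(t)` are indexed by `k ∪ {∞}`. This is the
valuation of the given place, written multiplicatively: `v_α` is attached to the prime `t - α` for
`α ∈ k`, and `v_∞` is the valuation with uniformizer `1 / t`. -/
def placeVal (p : OnePoint k) : Valuation (RatFunc k) (WithZero (Multiplicative ℤ)) :=
  p.elim (RatFunc.inftyValuation k) (fun α => (linearPrime α).valuation (RatFunc k))

/-- `φ ∈ k(t)(z)` of degree `d` has simple good reduction at the place `p`: it can be written as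
`F / G` with `F`, `G` of degree at most `d`, with coefficients integral at `p` and not all in the
maximal ideal, such that the resultant of the degree `d` homogenizations is a unit at `p`. -/
def HasSimpleGoodReduction (p : OnePoint k) (φ : RatFunc (RatFunc k)) : Prop :=
  ∃ F G : (RatFunc k)[X], G ≠ 0 ∧
    φ = algebraMap (RatFunc k)[X] (RatFunc (RatFunc k)) F / algebraMap _ _ G ∧
    F.natDegree ≤ mapDegree φ ∧ G.natDegree ≤ mapDegree φ ∧
    (∀ i, placeVal p (F.coeff i) ≤ 1) ∧ (∀ i, placeVal p (G.coeff i) ≤ 1) ∧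
    (∃ i, placeVal p (F.coeff i) = 1 ∨ placeVal p (G.coeff i) = 1) ∧
    placeVal p (resultant F G (mapDegree φ) (mapDegree φ)) = 1

/-- `φ` has good reduction at `p`: some conjugate by an element of `PGL₂(k(t))` (which may depend
on `p`) has simple good reduction at `p`. -/
def HasGoodReduction (p : OnePoint k) (φ : RatFunc (RatFunc k)) : Prop :=
  ∃ (A : GL (Fin 2) (RatFunc k)) (ψ : RatFunc (RatFunc k)),
    IsConjBy A φ ψ ∧ HasSimpleGoodReduction p ψ

/-- `φ ∈ k(t)(z)` is defined over `k`: it is a quotient of polynomials in `z` with coefficients in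
the constant field `k`. -/
def IsDefinedOverConstants (φ : RatFunc (RatFunc k)) : Prop :=
  ∃ f g : k[X], g ≠ 0 ∧
    φ = algebraMap (RatFunc k)[X] (RatFunc (RatFunc k)) (f.map (algebraMap k (RatFunc k))) /
      algebraMap _ _ (g.map (algebraMap k (RatFunc k)))

/-- `φ` is isotrivial over `K = k(t)`: some conjugate by an element of `PGL₂(K)` is defined
over `k`. -/
def IsIsotrivialOver (φ : RatFunc (RatFunc k)) : Prop :=
  ∃ (A : GL (Fin 2) (RatFunc k)) (ψ : RatFunc (RatFunc k)),
    IsConjBy A φ ψ ∧ IsDefinedOverConstants ψ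

end FunctionField

end ProjLineDyn

end

/-! Good reduction at a place gives an ultrametric distance on `ℙ¹(K)`, the chordal distance in a
suitable coordinate, which `φ` does not increase (`HasGoodReduction.exists_isAdapted`). The
valuations of a cross-ratio and of one minus it are products of such distances. So if three points
`A`, `B`, `C` are placed symmetrically enough with respect to the points `Q` of a set, at every
finite place outside `S`, then the cross-ratios of the `Q` are `S`-units `x` whose values `1 - x`
have valuations independent of `Q`.

Such non-constant `x` are bounded in number (`card_le_unitBound`). Dividing `1 - x` by one fixed `1
- x₀` gives a three-term unit equation. Logarithmic differentiation reduces it to Mason's theorem,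
which bounds heights, and divisors of bounded height supported on `S` are finite in number. If
instead many points `P` have constant cross-ratio together with `φ P`, then `φ`, in the coordinate
given by the cross-ratio, sends more than `2 d` constants to constants, and is therefore isotrivial.
Together these bound any such symmetric configuration (`card_le_of_equidistant`).

The configuration occurs in long cycles and in long tails. On a cycle, `φ` acts by isometries, so
the distance depends on the difference of indices only and the ultrametric inequality forces many
equalities (`minimalPeriod_le`). On a tail leading into a cycle of length `n`, the points `0`, `n`
and `2 n` steps before the cycle are equidistant from all points far enough back (`tail_length_le`).

With periods and preperiods bounded, a fixed iterate of `φ` sends all preperiodic points to fixed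
points of another fixed iterate. That iterate is not the identity, so degrees bound the count. -/

noncomputable section
namespace ProjLineDyn
open Polynomial

/-! ### Binary forms and their substitution. -/

section Forms

variable {R : Type*} [CommRing R]

/-- The value at `(x, y)` of the degree `n` homogenization of `p`. -/
def homEval (n : ℕ) (p : R[X]) (x y : R) : R :=
  ∑ i ∈ Finset.range (n + 1), p.coeff i * x ^ i * y ^ (n - i)

theorem homEval_add (n : ℕ) (p q : R[X]) (x y : R) :
    homEval n (p + q) x y = homEval n p x y + homEval n q x y := by
  simp only [homEval, coeff_add, add_mul, Finset.sum_add_distrib]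

theorem homEval_C_mul (n : ℕ) (c : R) (p : R[X]) (x y : R) :
    homEval n (C c * p) x y = c * homEval n p x y := by
  simp only [homEval, coeff_C_mul, Finset.mul_sum, mul_assoc]

theorem homEval_finset_sum {ι : Type*} (n : ℕ) (s : Finset ι) (p : ι → R[X]) (x y : R) :
    homEval n (∑ i ∈ s, p i) x y = ∑ i ∈ s, homEval n (p i) x y := by
  classical
  induction s using Finset.induction_on with
  | empty => simp [homEval]
  | insert a s ha ih => rw [Finset.sum_insert ha, Finset.sum_insert ha, homEval_add, ih]

theorem homEval_zero_right (n : ℕ) (p : R[X]) (x : R) :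
    homEval n p x 0 = p.coeff n * x ^ n := by
  rw [homEval, Finset.sum_range_succ, Finset.sum_eq_zero]
  · simp
  · intro i hi
    rw [zero_pow (by have := Finset.mem_range.1 hi; omega), mul_zero]

theorem homEval_one_right {n : ℕ} {p : R[X]} (hp : p.natDegree ≤ n) (x : R) :
    homEval n p x 1 = p.eval x := by
  rw [eval_eq_sum_range' (Nat.lt_succ_of_le hp)]
  simp [homEval]

theorem homEval_smul (n : ℕ) (p : R[X]) (c x y : R) :
    homEval n p (c * x) (c * y) = c ^ n * homEval n p x y := by
  rw [homEval, homEval, Finset.mul_sum]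
  refine Finset.sum_congr rfl fun i hi => ?_
  have : c ^ n = c ^ i * c ^ (n - i) := by
    rw [← pow_add]
    congr 1
    have := Finset.mem_range.1 hi
    omega
  rw [this, mul_pow, mul_pow]
  ring

theorem homEval_map {S : Type*} [CommRing S] (f : R →+* S) (n : ℕ) (p : R[X]) (x y : R) :
    homEval n (p.map f) (f x) (f y) = f (homEval n p x y) := by
  simp [homEval, map_sum]

/-- The determinant of the values of two forms at two vectors is divisible by the determinant
of the two vectors. -/
theorem det_dvd_homEval_det (n : ℕ) (p q : R[X]) (x₁ y₁ x₂ y₂ : R) :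
    x₁ * y₂ - x₂ * y₁ ∣
      homEval n p x₁ y₁ * homEval n q x₂ y₂ - homEval n p x₂ y₂ * homEval n q x₁ y₁ := by
  simp only [homEval, Finset.sum_mul_sum, ← Finset.sum_sub_distrib]
  -- For a pair of monomials a common factor splits off and `(x₁ y₂) ^ k - (x₂ y₁) ^ k` remains,
  -- with `k` the gap between the exponents.
  have key : ∀ (i k l : ℕ) (x₁ y₁ x₂ y₂ : R), x₁ * y₂ - x₂ * y₁ ∣
      x₁ ^ (i + k) * y₁ ^ l * (x₂ ^ i * y₂ ^ (l + k)) -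
        x₂ ^ (i + k) * y₂ ^ l * (x₁ ^ i * y₁ ^ (l + k)) := by
    intro i k l x₁ y₁ x₂ y₂
    have h := sub_dvd_pow_sub_pow (x₁ * y₂) (x₂ * y₁) k
    have h2 : x₁ ^ (i + k) * y₁ ^ l * (x₂ ^ i * y₂ ^ (l + k)) -
        x₂ ^ (i + k) * y₂ ^ l * (x₁ ^ i * y₁ ^ (l + k)) =
        ((x₁ * y₂) ^ k - (x₂ * y₁) ^ k) * (x₁ ^ i * y₁ ^ l * x₂ ^ i * y₂ ^ l) := by ring
    rw [h2]
    exact h.mul_right _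
  refine Finset.dvd_sum fun i hi => Finset.dvd_sum fun j hj => ?_
  have hi := Finset.mem_range.1 hi
  have hj := Finset.mem_range.1 hj
  rcases le_total j i with h | h
  · have := (key j (i - j) (n - i) x₁ y₁ x₂ y₂).mul_left (p.coeff i * q.coeff j)
    rw [show j + (i - j) = i by omega, show n - i + (i - j) = n - j by omega] at this
    convert this using 1
    ring
  · have := (key i (j - i) (n - j) x₂ y₂ x₁ y₁).mul_left (p.coeff i * q.coeff j)
    rw [show i + (j - i) = j by omega, show n - j + (j - i) = n - i by omega] at this
    rw [← neg_dvd, neg_sub] at this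
    convert this using 1
    ring

/-- Substitution of the pair of forms `f`, `g` in the form `p` of degree `n`. -/
def homComp (n : ℕ) (p f g : R[X]) : R[X] :=
  ∑ i ∈ Finset.range (n + 1), C (p.coeff i) * (f ^ i * g ^ (n - i))

theorem natDegree_homComp_le {n m : ℕ} (p : R[X]) {f g : R[X]} (hf : f.natDegree ≤ m)
    (hg : g.natDegree ≤ m) : (homComp n p f g).natDegree ≤ n * m := by
  refine natDegree_sum_le_of_forall_le _ _ fun i hi => ?_
  have hi := Finset.mem_range.1 hi
  refine (natDegree_C_mul_le _ _).trans (natDegree_mul_le.trans ?_)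
  have h1 := natDegree_pow_le_of_le i hf
  have h2 := natDegree_pow_le_of_le (n - i) hg
  calc _ ≤ i * m + (n - i) * m := add_le_add h1 h2
    _ = n * m := by rw [← add_mul]; congr 1; omega

end Forms

/-! ### Homogeneous coordinates and self-maps given by pairs of forms. -/

section Points

variable {K : Type*} [Field K]

theorem homEval_of_ne_zero {n : ℕ} {p : K[X]} (hp : p.natDegree ≤ n) (x : K) {y : K} (hy : y ≠ 0) :
    homEval n p x y = y ^ n * p.eval (x / y) := by
  rw [← homEval_one_right hp, ← homEval_smul]
  congr 1 <;> field_simp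

theorem homEval_mul {m n : ℕ} {p q : K[X]} (hp : p.natDegree ≤ m) (hq : q.natDegree ≤ n) (x y : K) :
    homEval (m + n) (p * q) x y = homEval m p x y * homEval n q x y := by
  by_cases hy : y = 0
  · subst hy
    rw [homEval_zero_right, homEval_zero_right, homEval_zero_right,
      coeff_mul_add_eq_of_natDegree_le hp hq]
    ring
  · rw [homEval_of_ne_zero (natDegree_mul_le.trans (add_le_add hp hq)) x hy,
      homEval_of_ne_zero hp x hy, homEval_of_ne_zero hq x hy, eval_mul]
    ring

theorem homEval_pow {m : ℕ} {p : K[X]} (hp : p.natDegree ≤ m) (i : ℕ) (x y : K) :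
    homEval (i * m) (p ^ i) x y = homEval m p x y ^ i := by
  induction i with
  | zero => simp [homEval]
  | succ i ih =>
    rw [pow_succ, pow_succ, add_mul, one_mul,
      homEval_mul (natDegree_pow_le_of_le i hp) hp, ih]

theorem homEval_homComp {n m : ℕ} (p : K[X]) {f g : K[X]} (hf : f.natDegree ≤ m)
    (hg : g.natDegree ≤ m) (x y : K) :
    homEval (n * m) (homComp n p f g) x y =
      homEval n p (homEval m f x y) (homEval m g x y) := by
  rw [homComp, homEval_finset_sum]
  conv_rhs => rw [homEval]
  refine Finset.sum_congr rfl fun i hi => ?_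
  have hi := Finset.mem_range.1 hi
  rw [homEval_C_mul, show n * m = i * m + (n - i) * m by rw [← add_mul]; congr 1; omega,
    homEval_mul (natDegree_pow_le_of_le i hf) (natDegree_pow_le_of_le _ hg), homEval_pow hf,
    homEval_pow hg, mul_assoc]

open Classical in
/-- The point `[x : y]` of `ℙ¹(K)`. -/
def toPt (x y : K) : OnePoint K := if y = 0 then OnePoint.infty else ((x / y : K) : OnePoint K)

/-- The first homogeneous coordinate of a point. -/
def xc (P : OnePoint K) : K := P.elim 1 id

/-- The second homogeneous coordinate of a point. -/
def yc (P : OnePoint K) : K := P.elim 0 (fun _ => 1)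

theorem toPt_xc_yc (P : OnePoint K) : toPt (xc P) (yc P) = P := by
  induction P using OnePoint.rec <;> simp [toPt, xc, yc]

theorem xc_ne_or_yc_ne (P : OnePoint K) : xc P ≠ 0 ∨ yc P ≠ 0 := by
  induction P using OnePoint.rec <;> simp [xc, yc]

theorem toPt_eq_iff {x y x' y' : K} (h : x ≠ 0 ∨ y ≠ 0) (h' : x' ≠ 0 ∨ y' ≠ 0) :
    toPt x y = toPt x' y' ↔ x * y' = x' * y := by
  by_cases hy : y = 0 <;> by_cases hy' : y' = 0
  · simp [toPt, hy, hy']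
  · simp only [hy, ne_eq, not_true_eq_false, or_false] at h
    simp [toPt, hy, hy', h]
  · simp only [hy', ne_eq, not_true_eq_false, or_false] at h'
    simp [toPt, hy, hy', h']
  · simp [toPt, hy, hy', div_eq_div_iff]

theorem toPt_smul {c : K} (hc : c ≠ 0) (x y : K) : toPt (c * x) (c * y) = toPt x y := by
  by_cases hy : y = 0
  · simp [toPt, hy]
  · simp [toPt, hy, hc, mul_div_mul_left _ _ hc]

theorem exists_coords_toPt {x y : K} (h : x ≠ 0 ∨ y ≠ 0) :
    ∃ c : K, c ≠ 0 ∧ x = c * xc (toPt x y) ∧ y = c * yc (toPt x y) := by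
  by_cases hy : y = 0
  · refine ⟨x, by simpa [hy] using h, ?_, ?_⟩ <;> simp [toPt, hy, xc, yc]
  · refine ⟨y, hy, ?_, ?_⟩
    · simp [toPt, hy, xc, mul_div_cancel₀]
    · simp [toPt, hy, yc]

theorem smul_toPt [DecidableEq K] (g : GL (Fin 2) K) {x y : K} (h : x ≠ 0 ∨ y ≠ 0) :
    g • toPt x y = toPt (g 0 0 * x + g 0 1 * y) (g 1 0 * x + g 1 1 * y) := by
  by_cases hy : y = 0
  · have hx : x ≠ 0 := by simpa [hy] using h
    simp only [toPt, hy, if_true, mul_zero, add_zero, OnePoint.smul_infty_eq_ite, mul_eq_zero, hx,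
      or_false, mul_div_mul_right _ _ hx]
  · have e : g 1 0 * (x / y) + g 1 1 = (g 1 0 * x + g 1 1 * y) / y := by field_simp
    have e' : g 0 0 * (x / y) + g 0 1 = (g 0 0 * x + g 0 1 * y) / y := by field_simp
    simp only [toPt, hy, if_false, OnePoint.smul_some_eq_ite, e, e', div_eq_zero_iff, or_false,
      div_div_div_cancel_right₀ hy]
    congr

theorem gl_coords_ne (g : GL (Fin 2) K) {x y : K} (h : x ≠ 0 ∨ y ≠ 0) :
    g 0 0 * x + g 0 1 * y ≠ 0 ∨ g 1 0 * x + g 1 1 * y ≠ 0 := by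
  by_contra! H
  have hd := g.det_ne_zero
  rw [Matrix.det_fin_two] at hd
  have hx : (g 0 0 * g 1 1 - g 0 1 * g 1 0) * x = 0 := by
    linear_combination g 1 1 * H.1 - g 0 1 * H.2
  have hy : (g 0 0 * g 1 1 - g 0 1 * g 1 0) * y = 0 := by
    linear_combination g 0 0 * H.2 - g 1 0 * H.1
  rcases h with h | h
  · exact (mul_ne_zero hd h) hx
  · exact (mul_ne_zero hd h) hy

/-- The self-map `T` of `ℙ¹(K)` is given by the pair of the degree `n` homogenizations of `f`
and `g`. -/
structure IsRep (T : OnePoint K → OnePoint K) (n : ℕ) (f g : K[X]) : Prop where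
  natDegree_left : f.natDegree ≤ n
  natDegree_right : g.natDegree ≤ n
  ne_zero : ∀ x y : K, (x ≠ 0 ∨ y ≠ 0) → homEval n f x y ≠ 0 ∨ homEval n g x y ≠ 0
  apply_toPt : ∀ x y : K, (x ≠ 0 ∨ y ≠ 0) →
    T (toPt x y) = toPt (homEval n f x y) (homEval n g x y)

namespace IsRep

theorem comp {T T' : OnePoint K → OnePoint K} {n m : ℕ} {p q f g : K[X]} (h : IsRep T n p q)
    (h' : IsRep T' m f g) : IsRep (T ∘ T') (n * m) (homComp n p f g) (homComp n q f g) where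
  natDegree_left := natDegree_homComp_le _ h'.1 h'.2
  natDegree_right := natDegree_homComp_le _ h'.1 h'.2
  ne_zero x y hxy := by
    rw [homEval_homComp _ h'.1 h'.2, homEval_homComp _ h'.1 h'.2]
    exact h.ne_zero _ _ (h'.ne_zero _ _ hxy)
  apply_toPt x y hxy := by
    rw [homEval_homComp _ h'.1 h'.2, homEval_homComp _ h'.1 h'.2, Function.comp_apply,
      h'.apply_toPt _ _ hxy, h.apply_toPt _ _ (h'.ne_zero _ _ hxy)]

theorem gl [DecidableEq K] (A : GL (Fin 2) K) :
    IsRep (fun P => A • P) 1 (C (A 0 0) * X + C (A 0 1)) (C (A 1 0) * X + C (A 1 1)) := by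
  have e : ∀ a b x y : K, homEval 1 (C a * X + C b) x y = a * x + b * y := by
    intro a b x y
    simp [homEval, Finset.sum_range_succ, coeff_X, coeff_C]
    ring
  refine ⟨natDegree_linear_le, natDegree_linear_le, fun x y h => ?_, fun x y h => ?_⟩
  · rw [e, e]; exact gl_coords_ne A h
  · rw [e, e]; exact smul_toPt A h

theorem const (P : OnePoint K) : IsRep (fun _ => P) 0 (C (xc P)) (C (yc P)) := by
  refine ⟨by simp, by simp, fun x y h => ?_, fun x y h => ?_⟩
  · simpa [homEval] using xc_ne_or_yc_ne P
  · simp [homEval, toPt_xc_yc]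

theorem id : IsRep (id : OnePoint K → OnePoint K) 1 X 1 := by
  have e : ∀ x y : K, homEval 1 X x y = x := by
    intro x y
    simp [homEval, coeff_X]
  have e' : ∀ x y : K, homEval 1 1 x y = y := by
    intro x y
    simp [homEval, coeff_one]
  refine ⟨by simp, by simp, fun x y h => ?_, fun x y h => ?_⟩
  · rw [e, e']; exact h
  · rw [e, e']; rfl

theorem toMap (φ : RatFunc K) : IsRep (toMap φ) (mapDegree φ) φ.num φ.denom := by
  have hn : φ.num.natDegree ≤ mapDegree φ := le_max_left _ _
  have hd : φ.denom.natDegree ≤ mapDegree φ := le_max_right _ _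
  refine ⟨hn, hd, fun x y h => ?_, fun x y h => ?_⟩
  · by_cases hy : y = 0
    · have hx : x ≠ 0 := by simpa [hy] using h
      rw [hy, homEval_zero_right, homEval_zero_right]
      have : φ.num.coeff (mapDegree φ) ≠ 0 ∨ φ.denom.coeff (mapDegree φ) ≠ 0 := by
        rcases le_total φ.num.natDegree φ.denom.natDegree with h1 | h1
        · right
          rw [mapDegree, max_eq_right h1, coeff_natDegree, leadingCoeff_ne_zero]
          exact φ.denom_ne_zero
        · by_cases h0 : φ.num = 0
          · right
            have : φ = 0 := RatFunc.num_eq_zero_iff.1 h0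
            subst this
            simp [mapDegree]
          · left
            rwa [mapDegree, max_eq_left h1, coeff_natDegree, leadingCoeff_ne_zero]
      exact this.imp (fun h => mul_ne_zero h (pow_ne_zero _ hx))
        (fun h => mul_ne_zero h (pow_ne_zero _ hx))
    · rw [homEval_of_ne_zero hn x hy, homEval_of_ne_zero hd x hy]
      by_contra! H
      have h1 := (mul_eq_zero.1 H.1).resolve_left (pow_ne_zero _ hy)
      have h2 := (mul_eq_zero.1 H.2).resolve_left (pow_ne_zero _ hy)
      obtain ⟨a, b, hab⟩ := φ.isCoprime_num_denom
      have := congrArg (eval (x / y)) hab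
      simp [h1, h2] at this
  · by_cases hy : y = 0
    · have hx : x ≠ 0 := by simpa [hy] using h
      rw [hy, homEval_zero_right, homEval_zero_right, mul_comm, mul_comm (φ.denom.coeff _),
        toPt_smul (pow_ne_zero _ hx)]
      simp [toPt, ProjLineDyn.toMap]
    · rw [homEval_of_ne_zero hn x hy, homEval_of_ne_zero hd x hy, toPt_smul (pow_ne_zero _ hy)]
      simp [toPt, ProjLineDyn.toMap, hy]

theorem iterate {T : OnePoint K → OnePoint K} {n : ℕ} {f g : K[X]} (h : IsRep T n f g) (m : ℕ) :
    ∃ f' g' : K[X], IsRep T^[m] (n ^ m) f' g' := by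
  induction m with
  | zero => exact ⟨X, 1, by simpa using IsRep.id⟩
  | succ m ih =>
    obtain ⟨f', g', h'⟩ := ih
    exact ⟨_, _, h'.comp h⟩

end IsRep

/-- A quotient of two polynomials without common zero as forms of degree `n` has degree at most
`n` and is given by these forms. -/
theorem isRep_toMap_div {n : ℕ} {f g : K[X]} (hg : g ≠ 0) (hfn : f.natDegree ≤ n)
    (hgn : g.natDegree ≤ n)
    (hne : ∀ x y : K, (x ≠ 0 ∨ y ≠ 0) → homEval n f x y ≠ 0 ∨ homEval n g x y ≠ 0) :
    IsRep (toMap (algebraMap K[X] (RatFunc K) f / algebraMap _ _ g)) n f g ∧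
      mapDegree (algebraMap K[X] (RatFunc K) f / algebraMap _ _ g) ≤ n := by
  set ψ := algebraMap K[X] (RatFunc K) f / algebraMap _ _ g with hψ
  have hcross : f * ψ.denom = ψ.num * g := by
    apply RatFunc.algebraMap_injective K
    have := RatFunc.num_div_denom ψ
    rw [hψ, div_eq_div_iff (RatFunc.algebraMap_ne_zero (RatFunc.denom_ne_zero _))
      (RatFunc.algebraMap_ne_zero hg), ← hψ] at this
    rw [map_mul, map_mul, this]
  obtain ⟨c, hc⟩ : ψ.denom ∣ g :=
    ψ.isCoprime_num_denom.symm.dvd_of_dvd_mul_left ⟨f, by rw [← hcross, mul_comm]⟩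
  have hf : f = ψ.num * c := by
    have : (f - ψ.num * c) * ψ.denom = 0 := by rw [sub_mul, hcross, hc]; ring
    exact sub_eq_zero.1 ((mul_eq_zero.1 this).resolve_right ψ.denom_ne_zero)
  have hc0 : c ≠ 0 := by rintro rfl; exact hg (by simpa using hc)
  have h1 : ψ.denom.natDegree + c.natDegree ≤ n := by
    rwa [← natDegree_mul ψ.denom_ne_zero hc0, ← hc]
  have h2 : ψ.num.natDegree + c.natDegree ≤ n := by
    by_cases h0 : ψ.num = 0
    · rw [h0, natDegree_zero]; omega
    · rwa [← natDegree_mul h0 hc0, ← hf]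
  have h3 : mapDegree ψ + c.natDegree ≤ n := by
    rw [mapDegree]; omega
  have hR := IsRep.toMap ψ
  -- The cancelled factor `c` is read as a form of degree `e`. It has no zero, since that would be a
  -- common zero of both given forms.
  obtain ⟨e, he⟩ : ∃ e, n = mapDegree ψ + e := ⟨n - mapDegree ψ, by omega⟩
  have hce : c.natDegree ≤ e := by omega
  have e1 : ∀ x y, homEval n f x y = homEval (mapDegree ψ) ψ.num x y * homEval e c x y := by
    intro x y; rw [he, hf, homEval_mul hR.1 hce]
  have e2 : ∀ x y, homEval n g x y = homEval (mapDegree ψ) ψ.denom x y * homEval e c x y := by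
    intro x y; rw [he, hc, homEval_mul hR.2 hce]
  refine ⟨⟨hfn, hgn, hne, fun x y hxy => ?_⟩, by omega⟩
  have hcne : homEval e c x y ≠ 0 := by
    intro h0
    have := hne x y hxy
    rw [e1, e2, h0] at this
    simp at this
  rw [e1, e2, hR.apply_toPt x y hxy, mul_comm, mul_comm _ (homEval e c x y), toPt_smul hcne]

theorem IsRep.exists_toMap_eq {T : OnePoint K → OnePoint K} {n : ℕ} {f g : K[X]}
    (h : IsRep T n f g) (hg : g ≠ 0) : ∃ ψ : RatFunc K, ProjLineDyn.toMap ψ = T ∧ mapDegree ψ ≤ n := by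
  obtain ⟨h1, h2⟩ := isRep_toMap_div hg h.1 h.2 h.3
  refine ⟨_, ?_, h2⟩
  funext P
  rw [← toPt_xc_yc P, h1.apply_toPt _ _ (xc_ne_or_yc_ne P), h.apply_toPt _ _ (xc_ne_or_yc_ne P)]

/-- Two self-maps of `ℙ¹(K)` of degrees `n` and `m` are equal or agree in at most `n + m + 1`
points. -/
theorem IsRep.finite_eqLocus {T T' : OnePoint K → OnePoint K} {n m : ℕ} {f g f' g' : K[X]}
    (h : IsRep T n f g) (h' : IsRep T' m f' g') (hne : T ≠ T') :
    {P | T P = T' P}.Finite ∧ {P | T P = T' P}.ncard ≤ n + m + 1 := by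
  classical
  set r : K[X] := f * g' - f' * g with hr
  have hdeg1 : (f * g').natDegree ≤ n + m := natDegree_mul_le.trans (add_le_add h.1 h'.2)
  have hdeg2 : (f' * g).natDegree ≤ n + m :=
    natDegree_mul_le.trans ((add_le_add h'.1 h.2).trans (add_comm m n).le)
  have hr0 : r ≠ 0 := by
    intro h0
    apply hne
    funext P
    rw [← toPt_xc_yc P, h.apply_toPt _ _ (xc_ne_or_yc_ne P), h'.apply_toPt _ _ (xc_ne_or_yc_ne P),
      toPt_eq_iff (h.ne_zero _ _ (xc_ne_or_yc_ne P)) (h'.ne_zero _ _ (xc_ne_or_yc_ne P)),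
      ← homEval_mul h.1 h'.2, ← homEval_mul h'.1 h.2, add_comm m n, sub_eq_zero.1 h0]
  -- The point `∞` is always admitted, which is the `+ 1` in the bound.
  have hsub : {P | T P = T' P} ⊆
      ((insert OnePoint.infty (r.roots.toFinset.image (fun x : K => (x : OnePoint K))) :
        Finset (OnePoint K)) : Set (OnePoint K)) := by
    intro P hP
    induction P using OnePoint.rec with
    | infty => simp
    | coe x =>
      have hx : (x : OnePoint K) = toPt x 1 := by simp [toPt]
      have h1 : (x ≠ 0 ∨ (1 : K) ≠ 0) := Or.inr one_ne_zero
      rw [Set.mem_ofPred_eq, hx, h.apply_toPt _ _ h1, h'.apply_toPt _ _ h1,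
        toPt_eq_iff (h.ne_zero _ _ h1) (h'.ne_zero _ _ h1), homEval_one_right h.1,
        homEval_one_right h.2, homEval_one_right h'.1, homEval_one_right h'.2] at hP
      have : r.eval x = 0 := by simp [hr, hP]
      simp [hr0, this]
  refine ⟨(Finset.finite_toSet _).subset hsub, ?_⟩
  refine (Set.ncard_le_ncard hsub (Finset.finite_toSet _)).trans ?_
  rw [Set.ncard_coe_finset]
  refine (Finset.card_insert_le _ _).trans (Nat.succ_le_succ ?_)
  refine Finset.card_image_le.trans ((Multiset.toFinset_card_le _).trans ((card_roots' r).trans ?_))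
  exact (natDegree_sub_le _ _).trans (max_le hdeg1 hdeg2)

end Points

/-! ### Chordal distance and cross-ratio. -/

section Chordal

variable {K : Type*} [Field K] {Γ : Type*} [LinearOrderedCommGroupWithZero Γ]

/-- The determinant of the homogeneous coordinates of two points. -/
def ptDet (P Q : OnePoint K) : K := xc P * yc Q - xc Q * yc P

/-- The chordal distance on `ℙ¹(K)` for a valuation `v`. -/
def chordal (v : Valuation K Γ) (P Q : OnePoint K) : Γ :=
  v (ptDet P Q) / (max (v (xc P)) (v (yc P)) * max (v (xc Q)) (v (yc Q)))

/-- The cross-ratio with `crossRatio A B C A = 0`, `crossRatio A B C B = ∞`,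
`crossRatio A B C C = 1`. -/
def crossRatio (A B C Q : OnePoint K) : K :=
  ptDet A Q * ptDet B C / (ptDet B Q * ptDet A C)

theorem ptDet_eq_zero {P Q : OnePoint K} : ptDet P Q = 0 ↔ P = Q := by
  rw [ptDet, sub_eq_zero, ← toPt_eq_iff (xc_ne_or_yc_ne P) (xc_ne_or_yc_ne Q), toPt_xc_yc,
    toPt_xc_yc]

theorem ptDet_ne_zero {P Q : OnePoint K} (h : P ≠ Q) : ptDet P Q ≠ 0 := mt ptDet_eq_zero.1 h

theorem max_val_ne_zero (v : Valuation K Γ) {x y : K} (h : x ≠ 0 ∨ y ≠ 0) :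
    max (v x) (v y) ≠ 0 := by
  rcases h with h | h
  · exact (lt_max_of_lt_left (zero_lt_iff.2 ((Valuation.ne_zero_iff v).2 h))).ne'
  · exact (lt_max_of_lt_right (zero_lt_iff.2 ((Valuation.ne_zero_iff v).2 h))).ne'

theorem max_val_smul (v : Valuation K Γ) (c x y : K) :
    max (v (c * x)) (v (c * y)) = v c * max (v x) (v y) := by
  rw [map_mul, map_mul, mul_max]

theorem exists_normalized_coords (v : Valuation K Γ) (P : OnePoint K) :
    ∃ x y : K, (x ≠ 0 ∨ y ≠ 0) ∧ P = toPt x y ∧ max (v x) (v y) = 1 := by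
  have key : ∀ c : K, c ≠ 0 → max (v (xc P)) (v (yc P)) = v c →
      ∃ x y : K, (x ≠ 0 ∨ y ≠ 0) ∧ P = toPt x y ∧ max (v x) (v y) = 1 := by
    intro c hc h
    refine ⟨c⁻¹ * xc P, c⁻¹ * yc P, ?_, ?_, ?_⟩
    · exact (xc_ne_or_yc_ne P).imp (mul_ne_zero (inv_ne_zero hc)) (mul_ne_zero (inv_ne_zero hc))
    · rw [toPt_smul (inv_ne_zero hc), toPt_xc_yc]
    · rw [max_val_smul, h, map_inv₀, inv_mul_cancel₀ ((Valuation.ne_zero_iff v).2 hc)]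
  have hne := max_val_ne_zero v (xc_ne_or_yc_ne P)
  rcases max_choice (v (xc P)) (v (yc P)) with h | h
  · exact key _ ((Valuation.ne_zero_iff v).1 (h ▸ hne)) h
  · exact key _ ((Valuation.ne_zero_iff v).1 (h ▸ hne)) h

theorem chordal_toPt (v : Valuation K Γ) {x y x' y' : K} (h : x ≠ 0 ∨ y ≠ 0)
    (h' : x' ≠ 0 ∨ y' ≠ 0) :
    chordal v (toPt x y) (toPt x' y') =
      v (x * y' - x' * y) / (max (v x) (v y) * max (v x') (v y')) := by
  obtain ⟨c, hc, hx, hy⟩ := exists_coords_toPt h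
  obtain ⟨c', hc', hx', hy'⟩ := exists_coords_toPt h'
  set P := toPt x y
  set Q := toPt x' y'
  have e : x * y' - x' * y = c * c' * ptDet P Q := by rw [hx, hy, hx', hy', ptDet]; ring
  have hvc : v c ≠ 0 := (Valuation.ne_zero_iff v).2 hc
  have hvc' : v c' ≠ 0 := (Valuation.ne_zero_iff v).2 hc'
  rw [e, hx, hy, hx', hy', max_val_smul, max_val_smul, chordal, map_mul, map_mul,
    mul_mul_mul_comm, mul_div_mul_left _ _ (mul_ne_zero hvc hvc')]

theorem chordal_symm (v : Valuation K Γ) (P Q : OnePoint K) : chordal v P Q = chordal v Q P := by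
  rw [chordal, chordal, mul_comm (max _ _), ptDet, Valuation.map_sub_swap, ← ptDet]

theorem chordal_eq_zero (v : Valuation K Γ) {P Q : OnePoint K} : chordal v P Q = 0 ↔ P = Q := by
  rw [chordal, div_eq_zero_iff, or_iff_left, map_eq_zero, ptDet_eq_zero]
  exact mul_ne_zero (max_val_ne_zero v (xc_ne_or_yc_ne P)) (max_val_ne_zero v (xc_ne_or_yc_ne Q))

theorem chordal_le_max (v : Valuation K Γ) (P Q R : OnePoint K) :
    chordal v P R ≤ max (chordal v P Q) (chordal v Q R) := by
  obtain ⟨x₁, y₁, h₁, rfl, e₁⟩ := exists_normalized_coords v P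
  obtain ⟨x₂, y₂, h₂, rfl, e₂⟩ := exists_normalized_coords v Q
  obtain ⟨x₃, y₃, h₃, rfl, e₃⟩ := exists_normalized_coords v R
  rw [chordal_toPt v h₁ h₂, chordal_toPt v h₁ h₃, chordal_toPt v h₂ h₃, e₁, e₂, e₃]
  simp only [mul_one, div_one]
  -- Plücker relation between the three determinants; `a` is a coordinate of the middle point of
  -- valuation `1`.
  have key : ∀ a b c : K, v a = 1 → v b ≤ 1 → v c ≤ 1 →
      a * (x₁ * y₃ - x₃ * y₁) = b * (x₁ * y₂ - x₂ * y₁) + c * (x₂ * y₃ - x₃ * y₂) →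
      v (x₁ * y₃ - x₃ * y₁) ≤ max (v (x₁ * y₂ - x₂ * y₁)) (v (x₂ * y₃ - x₃ * y₂)) := by
    intro a b c ha hb hc h
    have h1 := congrArg v h
    rw [map_mul, ha, one_mul] at h1
    rw [h1]
    refine (v.map_add _ _).trans (max_le_max ?_ ?_)
    · rw [map_mul]; exact mul_le_of_le_one_left' hb
    · rw [map_mul]; exact mul_le_of_le_one_left' hc
  have hx₁ : v x₁ ≤ 1 := e₁ ▸ le_max_left _ _
  have hy₁ : v y₁ ≤ 1 := e₁ ▸ le_max_right _ _
  have hx₃ : v x₃ ≤ 1 := e₃ ▸ le_max_left _ _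
  have hy₃ : v y₃ ≤ 1 := e₃ ▸ le_max_right _ _
  rcases max_choice (v x₂) (v y₂) with h | h
  · exact key x₂ x₃ x₁ (h ▸ e₂) hx₃ hx₁ (by ring)
  · exact key y₂ y₃ y₁ (h ▸ e₂) hy₃ hy₁ (by ring)

/-- Each of the four points occurs once above and once below, so the normalizing factors cancel. -/
theorem val_crossRatio (v : Valuation K Γ) (A B C Q : OnePoint K) :
    v (crossRatio A B C Q) =
      chordal v A Q * chordal v B C / (chordal v B Q * chordal v A C) := by
  have hA := max_val_ne_zero v (xc_ne_or_yc_ne A)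
  have hB := max_val_ne_zero v (xc_ne_or_yc_ne B)
  have hC := max_val_ne_zero v (xc_ne_or_yc_ne C)
  have hQ := max_val_ne_zero v (xc_ne_or_yc_ne Q)
  simp only [crossRatio, chordal, map_div₀, map_mul]
  generalize max (v (xc A)) (v (yc A)) = a at *
  generalize max (v (xc B)) (v (yc B)) = b at *
  generalize max (v (xc C)) (v (yc C)) = c at *
  generalize max (v (xc Q)) (v (yc Q)) = q at *
  field_simp

/-- The Plücker relation makes one minus a cross-ratio again a quotient of products of determinants.
-/
theorem one_sub_crossRatio {A B C Q : OnePoint K} (h : B ≠ Q) (h' : A ≠ C) :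
    1 - crossRatio A B C Q = ptDet A B * ptDet Q C / (ptDet B Q * ptDet A C) * (-1) := by
  have h1 := ptDet_ne_zero h
  have h2 := ptDet_ne_zero h'
  rw [crossRatio]
  field_simp
  simp only [ptDet]
  ring

theorem val_one_sub_crossRatio (v : Valuation K Γ) {A B C Q : OnePoint K} (h : B ≠ Q)
    (h' : A ≠ C) :
    v (1 - crossRatio A B C Q) =
      chordal v A B * chordal v Q C / (chordal v B Q * chordal v A C) := by
  have hA := max_val_ne_zero v (xc_ne_or_yc_ne A)
  have hB := max_val_ne_zero v (xc_ne_or_yc_ne B)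
  have hC := max_val_ne_zero v (xc_ne_or_yc_ne C)
  have hQ := max_val_ne_zero v (xc_ne_or_yc_ne Q)
  rw [one_sub_crossRatio h h']
  simp only [chordal, map_div₀, map_mul, Valuation.map_neg, map_one, mul_one]
  generalize max (v (xc A)) (v (yc A)) = a at *
  generalize max (v (xc B)) (v (yc B)) = b at *
  generalize max (v (xc C)) (v (yc C)) = c at *
  generalize max (v (xc Q)) (v (yc Q)) = q at *
  field_simp

theorem exists_ptDet_smul [DecidableEq K] (g : GL (Fin 2) K) :
    ∃ c : OnePoint K → K, (∀ P, c P ≠ 0) ∧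
      ∀ P Q, c P * c Q * ptDet (g • P) (g • Q) = g.1.det * ptDet P Q := by
  have h : ∀ P : OnePoint K, ∃ c : K, c ≠ 0 ∧ g 0 0 * xc P + g 0 1 * yc P = c * xc (g • P) ∧
      g 1 0 * xc P + g 1 1 * yc P = c * yc (g • P) := by
    intro P
    have := exists_coords_toPt (gl_coords_ne g (xc_ne_or_yc_ne P))
    rwa [← smul_toPt g (xc_ne_or_yc_ne P), toPt_xc_yc] at this
  choose c hc hx hy using h
  refine ⟨c, hc, fun P Q => ?_⟩
  calc c P * c Q * ptDet (g • P) (g • Q)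
      = (c P * xc (g • P)) * (c Q * yc (g • Q)) - (c Q * xc (g • Q)) * (c P * yc (g • P)) := by
        rw [ptDet]; ring
    _ = g.1.det * ptDet P Q := by
        rw [← hx, ← hx, ← hy, ← hy, Matrix.det_fin_two, ptDet]; ring

theorem crossRatio_smul [DecidableEq K] (g : GL (Fin 2) K) (A B C Q : OnePoint K) :
    crossRatio (g • A) (g • B) (g • C) (g • Q) = crossRatio A B C Q := by
  obtain ⟨c, hc, h⟩ := exists_ptDet_smul g
  have hd : g.1.det ≠ 0 := g.det_ne_zero
  have h' : ∀ P Q, ptDet (g • P) (g • Q) = g.1.det * ptDet P Q / (c P * c Q) := by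
    intro P Q
    rw [eq_div_iff (mul_ne_zero (hc P) (hc Q)), ← h]
    ring
  simp only [crossRatio, h']
  have hA := hc A
  have hB := hc B
  have hC := hc C
  have hQ := hc Q
  field_simp

/-- The Möbius transformation `Q ↦ crossRatio A B C Q`. -/
theorem exists_smul_eq_crossRatio [DecidableEq K] {A B C : OnePoint K} (hAB : A ≠ B) (hAC : A ≠ C)
    (hBC : B ≠ C) :
    ∃ g : GL (Fin 2) K, ∀ Q, Q ≠ B → g • Q = ((crossRatio A B C Q : K) : OnePoint K) := by
  set M : Matrix (Fin 2) (Fin 2) K :=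
    !![-(yc A) * ptDet B C, xc A * ptDet B C; -(yc B) * ptDet A C, xc B * ptDet A C] with hM
  have hdet : M.det ≠ 0 := by
    have : M.det = ptDet B C * ptDet A C * ptDet A B := by
      rw [hM, Matrix.det_fin_two_of]; simp only [ptDet]; ring
    rw [this]
    exact mul_ne_zero (mul_ne_zero (ptDet_ne_zero hBC) (ptDet_ne_zero hAC)) (ptDet_ne_zero hAB)
  refine ⟨Matrix.GeneralLinearGroup.mkOfDetNeZero M hdet, fun Q hQ => ?_⟩
  conv_lhs => rw [← toPt_xc_yc Q]
  rw [smul_toPt _ (xc_ne_or_yc_ne Q)]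
  have e0 : M 0 0 * xc Q + M 0 1 * yc Q = ptDet A Q * ptDet B C := by
    simp [hM, ptDet]; ring
  have e1 : M 1 0 * xc Q + M 1 1 * yc Q = ptDet B Q * ptDet A C := by
    simp [hM, ptDet]; ring
  change toPt (M 0 0 * xc Q + M 0 1 * yc Q) (M 1 0 * xc Q + M 1 1 * yc Q) = _
  rw [e0, e1, toPt, if_neg (mul_ne_zero (ptDet_ne_zero hQ.symm) (ptDet_ne_zero hAC)), crossRatio]

end Chordal

/-! ### Good reduction makes a map non-expanding. -/

section Reduction

variable {K : Type*} [Field K] {Γ : Type*} [LinearOrderedCommGroupWithZero Γ]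

theorem val_homEval_le_one (v : Valuation K Γ) {n : ℕ} {p : K[X]} (hp : ∀ i, v (p.coeff i) ≤ 1)
    {x y : K} (hx : v x ≤ 1) (hy : v y ≤ 1) : v (homEval n p x y) ≤ 1 := by
  refine v.map_sum_le fun i _ => ?_
  rw [map_mul, map_mul, map_pow, map_pow]
  exact mul_le_one' (mul_le_one' (hp i) (pow_le_one' hx _)) (pow_le_one' hy _)

theorem exists_map_subtype_eq (v : Valuation K Γ) {p : K[X]} (hp : ∀ i, v (p.coeff i) ≤ 1) :
    ∃ q : v.valuationSubring[X], q.map v.valuationSubring.subtype = p := by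
  have : p ∈ Polynomial.lifts v.valuationSubring.subtype := by
    rw [Polynomial.lifts_iff_coeff_lifts]
    intro i
    exact ⟨⟨p.coeff i, hp i⟩, rfl⟩
  obtain ⟨q, hq⟩ := this
  exact ⟨q, hq⟩

theorem val_homEval_det_le (v : Valuation K Γ) (n : ℕ) {p q : K[X]} (hp : ∀ i, v (p.coeff i) ≤ 1)
    (hq : ∀ i, v (q.coeff i) ≤ 1) {x₁ y₁ x₂ y₂ : K} (hx₁ : v x₁ ≤ 1) (hy₁ : v y₁ ≤ 1)
    (hx₂ : v x₂ ≤ 1) (hy₂ : v y₂ ≤ 1) :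
    v (homEval n p x₁ y₁ * homEval n q x₂ y₂ - homEval n p x₂ y₂ * homEval n q x₁ y₁) ≤
      v (x₁ * y₂ - x₂ * y₁) := by
  obtain ⟨p, rfl⟩ := exists_map_subtype_eq v hp
  obtain ⟨q, rfl⟩ := exists_map_subtype_eq v hq
  lift x₁ to v.valuationSubring using hx₁
  lift y₁ to v.valuationSubring using hy₁
  lift x₂ to v.valuationSubring using hx₂
  lift y₂ to v.valuationSubring using hy₂
  obtain ⟨c, hc⟩ := det_dvd_homEval_det n p q x₁ y₁ x₂ y₂
  have e : ∀ (r : v.valuationSubring[X]) (x y : v.valuationSubring),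
      homEval n (r.map v.valuationSubring.subtype) (x : K) (y : K) =
        ((homEval n r x y : v.valuationSubring) : K) :=
    fun r x y => homEval_map v.valuationSubring.subtype n r x y
  rw [e, e, e, e]
  have := congrArg (fun z : v.valuationSubring => v (z : K)) hc
  simp only [MulMemClass.coe_mul, AddSubgroupClass.coe_sub, map_mul] at this
  rw [this]
  exact mul_le_of_le_one_right' c.2

/-- The resultant is a combination of `p` and `q` over the valuation ring, so a common zero in the
residue field would make it a non-unit. -/
theorem max_val_eval_eq_one (v : Valuation K Γ) {n : ℕ} {p q : K[X]} (hn : n ≠ 0)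
    (hpn : p.natDegree ≤ n) (hqn : q.natDegree ≤ n) (hp : ∀ i, v (p.coeff i) ≤ 1)
    (hq : ∀ i, v (q.coeff i) ≤ 1) (hres : v (resultant p q n n) = 1) {x : K} (hx : v x ≤ 1) :
    v (p.eval x) = 1 ∨ v (q.eval x) = 1 := by
  obtain ⟨p, rfl⟩ := exists_map_subtype_eq v hp
  obtain ⟨q, rfl⟩ := exists_map_subtype_eq v hq
  have hinj : Function.Injective v.valuationSubring.subtype := Subtype.val_injective
  rw [natDegree_map_eq_of_injective hinj] at hpn hqn
  lift x to v.valuationSubring using hx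
  rw [resultant_map_map] at hres
  obtain ⟨a, b, -, -, hab⟩ := exists_mul_add_mul_eq_C_resultant p q hpn hqn (Or.inl hn)
  have h1 := congrArg (eval x) hab
  rw [eval_add, eval_mul, eval_mul, eval_C] at h1
  have e : ∀ r : v.valuationSubring[X],
      (r.map v.valuationSubring.subtype).eval (x : K) = ((r.eval x : v.valuationSubring) : K) :=
    fun r => eval_map_apply v.valuationSubring.subtype x
  rw [e, e]
  by_contra! H
  have hp1 := lt_of_le_of_ne (p.eval x).2 H.1
  have hq1 := lt_of_le_of_ne (q.eval x).2 H.2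
  have : v (v.valuationSubring.subtype (resultant p q n n)) < 1 := by
    rw [← h1]
    simp only [map_add, map_mul]
    refine v.map_add_lt ?_ ?_
    · rw [map_mul]; exact mul_lt_one_of_lt_of_le hp1 (a.eval x).2
    · rw [map_mul]; exact mul_lt_one_of_lt_of_le hq1 (b.eval x).2
  exact this.ne hres

/-- The counterpart of `max_val_eval_eq_one` at `∞`: if both coefficients of degree `n` reduce to
zero, both reductions have degree below `n` and the resultant of format `(n, n)` reduces to zero. -/
theorem val_coeff_eq_one (v : Valuation K Γ) {n : ℕ} {p q : K[X]} (hn : n ≠ 0)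
    (hpn : p.natDegree ≤ n) (hqn : q.natDegree ≤ n) (hp : ∀ i, v (p.coeff i) ≤ 1)
    (hq : ∀ i, v (q.coeff i) ≤ 1) (hres : v (resultant p q n n) = 1) :
    v (p.coeff n) = 1 ∨ v (q.coeff n) = 1 := by
  obtain ⟨p, rfl⟩ := exists_map_subtype_eq v hp
  obtain ⟨q, rfl⟩ := exists_map_subtype_eq v hq
  have hinj : Function.Injective v.valuationSubring.subtype := Subtype.val_injective
  rw [natDegree_map_eq_of_injective hinj] at hpn hqn
  rw [resultant_map_map] at hres
  by_contra! H
  have hmem : ∀ z : v.valuationSubring, v (z : K) ≠ 1 →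
      IsLocalRing.residue v.valuationSubring z = 0 := by
    intro z hz
    rw [IsLocalRing.residue_eq_zero_iff, IsLocalRing.mem_maximalIdeal, mem_nonunits_iff]
    intro hu
    apply hz
    obtain ⟨w, hw⟩ := hu.exists_right_inv
    have h1 := congrArg (fun z : v.valuationSubring => v (z : K)) hw
    simp only [MulMemClass.coe_mul, map_mul, OneMemClass.coe_one, map_one] at h1
    exact le_antisymm z.2 (h1 ▸ mul_le_of_le_one_right' w.2)
  have hdeg : ∀ r : v.valuationSubring[X], r.natDegree ≤ n →
      v ((r.map v.valuationSubring.subtype).coeff n) ≠ 1 →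
      (r.map (IsLocalRing.residue v.valuationSubring)).natDegree < n := by
    intro r hr h
    rw [coeff_map] at h
    refine lt_of_le_of_ne (natDegree_map_le.trans hr) fun h0 => ?_
    have h2 : (r.map (IsLocalRing.residue v.valuationSubring)).coeff n = 0 := by
      rw [coeff_map]; exact hmem _ h
    have h3 : r.map (IsLocalRing.residue v.valuationSubring) = 0 := by
      rw [← leadingCoeff_eq_zero, ← coeff_natDegree, h0, h2]
    rw [h3, natDegree_zero] at h0
    exact hn h0.symm
  have h0 := resultant_eq_zero_of_lt_lt _ _ _ _ (hdeg p hpn H.1) (hdeg q hqn H.2)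
  rw [resultant_map_map, IsLocalRing.residue_eq_zero_iff, IsLocalRing.mem_maximalIdeal,
    mem_nonunits_iff] at h0
  apply h0
  have hr0 : v.valuationSubring.subtype (resultant p q n n) ≠ 0 := by
    intro h; rw [h, map_zero] at hres; exact zero_ne_one hres
  refine IsUnit.of_mul_eq_one ⟨(v.valuationSubring.subtype (resultant p q n n))⁻¹, ?_⟩ ?_
  · rw [Valuation.mem_valuationSubring_iff, map_inv₀, hres, inv_one]
  · ext
    exact mul_inv_cancel₀ hr0

theorem max_val_homEval_eq_one (v : Valuation K Γ) {n : ℕ} {p q : K[X]}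
    (hpn : p.natDegree ≤ n) (hqn : q.natDegree ≤ n) (hp : ∀ i, v (p.coeff i) ≤ 1)
    (hq : ∀ i, v (q.coeff i) ≤ 1) (hu : ∃ i, v (p.coeff i) = 1 ∨ v (q.coeff i) = 1)
    (hres : v (resultant p q n n) = 1) {x y : K} (hxy : max (v x) (v y) = 1) :
    max (v (homEval n p x y)) (v (homEval n q x y)) = 1 := by
  have hx : v x ≤ 1 := hxy ▸ le_max_left _ _
  have hy : v y ≤ 1 := hxy ▸ le_max_right _ _
  have hle1 := val_homEval_le_one v (n := n) hp hx hy
  have hle2 := val_homEval_le_one v (n := n) hq hx hy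
  suffices h : v (homEval n p x y) = 1 ∨ v (homEval n q x y) = 1 by
    refine le_antisymm (max_le hle1 hle2) ?_
    rcases h with h | h
    · exact h ▸ le_max_left _ _
    · exact h ▸ le_max_right _ _
  -- In degree `0` the resultant carries no information, and the unit coefficient from `hu` takes
  -- its place.
  by_cases hn : n = 0
  · subst hn
    obtain ⟨i, hi⟩ := hu
    have hi0 : i = 0 := by
      by_contra h0
      rw [coeff_eq_zero_of_natDegree_lt (by omega), coeff_eq_zero_of_natDegree_lt (by omega)] at hi
      simp at hi
    subst hi0
    simpa [homEval] using hi
  by_cases hy1 : v y = 1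
  · have hy0 : y ≠ 0 := by rintro rfl; simp at hy1
    have := max_val_eval_eq_one v hn hpn hqn hp hq hres (x := x / y) (by rwa [map_div₀, hy1, div_one])
    rw [homEval_of_ne_zero hpn x hy0, homEval_of_ne_zero hqn x hy0]
    simpa [hy1] using this
  · have hy1 : v y < 1 := lt_of_le_of_ne hy hy1
    have hx1 : v x = 1 := by
      rcases max_choice (v x) (v y) with h | h
      · rw [← h, hxy]
      · rw [hxy] at h; exact absurd h hy1.ne'
    -- The point reduces to `∞`: modulo the maximal ideal only the monomial `x ^ n` survives.
    have key : ∀ r : K[X], (∀ i, v (r.coeff i) ≤ 1) → v (r.coeff n) = 1 →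
        v (homEval n r x y) = 1 := by
      intro r hr hrn
      have h1 : v (r.coeff n * x ^ n * y ^ (n - n)) = 1 := by simp [hrn, hx1]
      rw [homEval, Finset.sum_range_succ, Valuation.map_add_eq_of_lt_right, h1]
      rw [h1]
      refine v.map_sum_lt one_ne_zero fun i hi => ?_
      have hi := Finset.mem_range.1 hi
      rw [map_mul, map_mul, map_pow, map_pow, hx1, one_pow, mul_one]
      exact (mul_le_of_le_one_left' (hr i)).trans_lt (pow_lt_one₀ zero_le hy1 (by omega))
    exact (val_coeff_eq_one v hn hpn hqn hp hq hres).imp (key p hp) (key q hq)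

/-- A distance on `ℙ¹(K)` that computes the valuations of cross-ratios and is not expanded
by `T`. -/
structure IsAdapted (v : Valuation K Γ) (T : OnePoint K → OnePoint K)
    (δ : OnePoint K → OnePoint K → Γ) : Prop where
  symm : ∀ P Q, δ P Q = δ Q P
  eq_zero_iff : ∀ {P Q}, δ P Q = 0 ↔ P = Q
  le_max : ∀ P Q R, δ P R ≤ max (δ P Q) (δ Q R)
  map_le : ∀ P Q, δ (T P) (T Q) ≤ δ P Q
  val_crossRatio : ∀ A B C Q, v (crossRatio A B C Q) = δ A Q * δ B C / (δ B Q * δ A C)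
  val_one_sub_crossRatio : ∀ {A B C Q}, B ≠ Q → A ≠ C →
    v (1 - crossRatio A B C Q) = δ A B * δ Q C / (δ B Q * δ A C)

/-- Normalized coordinates go to normalized coordinates by `max_val_homEval_eq_one`, so distances
are valuations of determinants, and these do not grow because of `det_dvd_homEval_det`. -/
theorem isAdapted_chordal (v : Valuation K Γ) {n : ℕ} {p q : K[X]} (hq0 : q ≠ 0)
    (hpn : p.natDegree ≤ n) (hqn : q.natDegree ≤ n) (hp : ∀ i, v (p.coeff i) ≤ 1)
    (hq : ∀ i, v (q.coeff i) ≤ 1) (hu : ∃ i, v (p.coeff i) = 1 ∨ v (q.coeff i) = 1)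
    (hres : v (resultant p q n n) = 1) :
    IsAdapted v (toMap (algebraMap K[X] (RatFunc K) p / algebraMap _ _ q)) (chordal v) where
  symm := chordal_symm v
  eq_zero_iff := chordal_eq_zero v
  le_max := chordal_le_max v
  val_crossRatio := val_crossRatio v
  val_one_sub_crossRatio := val_one_sub_crossRatio v
  map_le P Q := by
    have hmax : ∀ x y : K, max (v x) (v y) = 1 →
        max (v (homEval n p x y)) (v (homEval n q x y)) = 1 :=
      fun x y => max_val_homEval_eq_one v hpn hqn hp hq hu hres
    have hne1 : ∀ x y : K, max (v x) (v y) = 1 → homEval n p x y ≠ 0 ∨ homEval n q x y ≠ 0 := by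
      intro x y h
      by_contra! H
      have := hmax x y h
      rw [H.1, H.2, map_zero, max_self] at this
      exact zero_ne_one this
    have hne : ∀ x y : K, (x ≠ 0 ∨ y ≠ 0) → homEval n p x y ≠ 0 ∨ homEval n q x y ≠ 0 := by
      intro x y h
      obtain ⟨x', y', h', he, hm⟩ := exists_normalized_coords v (toPt x y)
      obtain ⟨c, hc, hx, hy⟩ := exists_coords_toPt h
      obtain ⟨c', hc', hx', hy'⟩ := exists_coords_toPt h'
      rw [← he] at hx' hy'
      have hcc : c / c' ≠ 0 := div_ne_zero hc hc'
      have ex : x = c / c' * x' := by rw [hx']; field_simp; exact hx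
      have ey : y = c / c' * y' := by rw [hy']; field_simp; exact hy
      rw [ex, ey, homEval_smul, homEval_smul]
      exact (hne1 x' y' hm).imp (mul_ne_zero (pow_ne_zero _ hcc)) (mul_ne_zero (pow_ne_zero _ hcc))
    have hR := (isRep_toMap_div hq0 hpn hqn hne).1
    obtain ⟨x₁, y₁, h₁, rfl, e₁⟩ := exists_normalized_coords v P
    obtain ⟨x₂, y₂, h₂, rfl, e₂⟩ := exists_normalized_coords v Q
    rw [hR.apply_toPt _ _ h₁, hR.apply_toPt _ _ h₂, chordal_toPt v (hne _ _ h₁) (hne _ _ h₂),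
      chordal_toPt v h₁ h₂, e₁, e₂, hmax _ _ e₁, hmax _ _ e₂]
    simp only [mul_one, div_one]
    exact val_homEval_det_le v n hp hq (e₁ ▸ le_max_left _ _) (e₁ ▸ le_max_right _ _)
      (e₂ ▸ le_max_left _ _) (e₂ ▸ le_max_right _ _)

end Reduction

/-- The chordal distance is pulled back along the conjugating matrix. That matrix varies with the
place, but cross-ratios are invariant, so all places speak about the same functions. -/
theorem HasGoodReduction.exists_isAdapted {k : Type*} [Field k] {p : OnePoint k}
    {φ : RatFunc (RatFunc k)} (h : HasGoodReduction p φ) :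
    ∃ δ, IsAdapted (placeVal p) (toMap φ) δ := by
  classical
  obtain ⟨A, ψ, hconj, F, G, hG, hψ, hF1, hG1, hF2, hG2, hu, hres⟩ := h
  have had := isAdapted_chordal (placeVal p) hG hF1 hG1 hF2 hG2 hu hres
  rw [← hψ] at had
  have hA : ∀ P, toMap ψ (A • P) = A • toMap φ P := by
    intro P
    have := hconj (A • P)
    rw [inv_smul_smul] at this
    convert this
  refine ⟨fun P Q => chordal (placeVal p) (A • P) (A • Q), ?_, ?_, ?_, ?_, ?_, ?_⟩
  · intro P Q; exact had.symm _ _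
  · intro P Q; rw [had.eq_zero_iff, smul_left_cancel_iff]
  · intro P Q R; exact had.le_max _ _ _
  · intro P Q
    simp only [← hA]
    exact had.map_le _ _
  · intro A' B C Q
    rw [← had.val_crossRatio, crossRatio_smul]
  · intro A' B C Q h1 h2
    rw [← crossRatio_smul A]
    exact had.val_one_sub_crossRatio (by simpa using h1) (by simpa using h2)

/-! ### Heights on `k(t)`. -/

section Height

variable {k : Type*} [Field k]

/-- `x ∈ k(t)` is a quotient of polynomials of degree at most `n`. -/
def HeightLE (n : ℕ) (x : RatFunc k) : Prop :=
  ∃ p q : k[X], q ≠ 0 ∧ x = algebraMap k[X] (RatFunc k) p / algebraMap _ _ q ∧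
    p.natDegree ≤ n ∧ q.natDegree ≤ n

theorem algebraMap_const (c : k) :
    algebraMap k (RatFunc k) c = algebraMap k[X] (RatFunc k) (C c) := by
  rw [← Polynomial.algebraMap_eq, ← IsScalarTower.algebraMap_apply]

namespace HeightLE

variable {m n : ℕ} {x y : RatFunc k}

theorem mono (h : HeightLE m x) (hmn : m ≤ n) : HeightLE n x := by
  obtain ⟨p, q, hq, hx, h1, h2⟩ := h
  exact ⟨p, q, hq, hx, h1.trans hmn, h2.trans hmn⟩

theorem poly {p : k[X]} (hp : p.natDegree ≤ n) : HeightLE n (algebraMap k[X] (RatFunc k) p) :=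
  ⟨p, 1, one_ne_zero, by simp, hp, by simp⟩

theorem const (n : ℕ) (c : k) : HeightLE n (algebraMap k (RatFunc k) c) := by
  rw [algebraMap_const]
  exact poly (by simp)

theorem mul (hx : HeightLE m x) (hy : HeightLE n y) : HeightLE (m + n) (x * y) := by
  obtain ⟨p, q, hq, rfl, h1, h2⟩ := hx
  obtain ⟨p', q', hq', rfl, h1', h2'⟩ := hy
  refine ⟨p * p', q * q', mul_ne_zero hq hq', ?_, natDegree_mul_le.trans (add_le_add h1 h1'),
    natDegree_mul_le.trans (add_le_add h2 h2')⟩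
  rw [map_mul, map_mul, div_mul_div_comm]

theorem add (hx : HeightLE m x) (hy : HeightLE n y) : HeightLE (m + n) (x + y) := by
  obtain ⟨p, q, hq, rfl, h1, h2⟩ := hx
  obtain ⟨p', q', hq', rfl, h1', h2'⟩ := hy
  refine ⟨p * q' + q * p', q * q', mul_ne_zero hq hq', ?_, ?_,
    natDegree_mul_le.trans (add_le_add h2 h2')⟩
  · rw [map_add, map_mul, map_mul, map_mul, div_add_div _ _ (RatFunc.algebraMap_ne_zero hq)
      (RatFunc.algebraMap_ne_zero hq')]
  · exact natDegree_add_le_of_degree_le (natDegree_mul_le.trans (add_le_add h1 h2'))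
      (natDegree_mul_le.trans (add_le_add h2 h1'))

theorem neg (hx : HeightLE n x) : HeightLE n (-x) := by
  obtain ⟨p, q, hq, rfl, h1, h2⟩ := hx
  exact ⟨-p, q, hq, by rw [map_neg, neg_div], by rwa [natDegree_neg], h2⟩

theorem inv (hx : HeightLE n x) : HeightLE n x⁻¹ := by
  obtain ⟨p, q, hq, rfl, h1, h2⟩ := hx
  by_cases hp : p = 0
  · exact ⟨0, 1, one_ne_zero, by simp [hp], by simp, by simp⟩
  · exact ⟨q, p, hp, by rw [inv_div], h2, h1⟩

theorem div (hx : HeightLE m x) (hy : HeightLE n y) : HeightLE (m + n) (x / y) := by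
  rw [div_eq_mul_inv]
  exact hx.mul hy.inv

theorem one_sub (hx : HeightLE n x) : HeightLE n (1 - x) := by
  have := (const 0 (1 : k)).add hx.neg
  rwa [zero_add, map_one, ← sub_eq_add_neg] at this

theorem natDegree_le (hx : HeightLE n x) : x.num.natDegree ≤ n ∧ x.denom.natDegree ≤ n := by
  obtain ⟨p, q, hq, rfl, h1, h2⟩ := hx
  refine ⟨?_, (natDegree_le_of_dvd (RatFunc.denom_div_dvd p q) hq).trans h2⟩
  by_cases hp : p = 0
  · simp [hp]
  · exact (natDegree_le_of_dvd (RatFunc.num_div_dvd p hq) hp).trans h1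

end HeightLE

theorem heightLE_num_denom {n : ℕ} {x : RatFunc k} (h1 : x.num.natDegree ≤ n)
    (h2 : x.denom.natDegree ≤ n) : HeightLE n x :=
  ⟨x.num, x.denom, x.denom_ne_zero, (RatFunc.num_div_denom x).symm, h1, h2⟩

end Height

/-! ### Unit equations over `k(t)`. -/

section Units

variable {k : Type*} [Field k]

/-- `x` has valuation `1` at all places `v_α` with `α ∉ T`. -/
def IsUnitOutside (T : Finset k) (x : RatFunc k) : Prop :=
  ∀ α, α ∉ T → (linearPrime α).valuation (RatFunc k) x = 1

theorem valuation_poly_eq_one_iff {α : k} {p : k[X]} :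
    (linearPrime α).valuation (RatFunc k) (algebraMap k[X] (RatFunc k) p) = 1 ↔ p.eval α ≠ 0 := by
  rw [IsDedekindDomain.HeightOneSpectrum.valuation_eq_one_iff_notMem]
  change p ∉ Ideal.span {X - C α} ↔ _
  rw [Ideal.mem_span_singleton, dvd_iff_isRoot, IsRoot.def]

theorem eval_num_denom_ne_zero {α : k} {x : RatFunc k}
    (h : (linearPrime α).valuation (RatFunc k) x = 1) :
    x.num.eval α ≠ 0 ∧ x.denom.eval α ≠ 0 := by
  rw [← RatFunc.num_div_denom x, map_div₀] at h
  have hd : (linearPrime α).valuation (RatFunc k) (algebraMap k[X] (RatFunc k) x.denom) ≠ 0 :=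
    (Valuation.ne_zero_iff _).2 (RatFunc.algebraMap_ne_zero x.denom_ne_zero)
  have h' := (div_eq_one_iff_eq hd).1 h
  have hiff : x.num.eval α ≠ 0 ↔ x.denom.eval α ≠ 0 := by
    rw [← valuation_poly_eq_one_iff, ← valuation_poly_eq_one_iff, h']
  have : x.denom.eval α ≠ 0 := by
    intro h0
    have h1 := not_ne_iff.1 (mt hiff.1 (not_ne_iff.2 h0))
    obtain ⟨a, b, hab⟩ := x.isCoprime_num_denom
    have := congrArg (eval α) hab
    simp [h0, h1] at this
  exact ⟨hiff.2 this, this⟩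

namespace IsUnitOutside

variable {T T' : Finset k} {x y : RatFunc k}

theorem mono (h : IsUnitOutside T x) (hT : T ⊆ T') : IsUnitOutside T' x :=
  fun α hα => h α fun hα' => hα (hT hα')

theorem mul (hx : IsUnitOutside T x) (hy : IsUnitOutside T y) : IsUnitOutside T (x * y) :=
  fun α hα => by rw [map_mul, hx α hα, hy α hα, one_mul]

theorem div (hx : IsUnitOutside T x) (hy : IsUnitOutside T y) : IsUnitOutside T (x / y) :=
  fun α hα => by rw [map_div₀, hx α hα, hy α hα, div_one]

theorem neg (hx : IsUnitOutside T x) : IsUnitOutside T (-x) :=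
  fun α hα => by rw [Valuation.map_neg, hx α hα]

theorem poly {p : k[X]} (h : ∀ α, p.eval α = 0 → α ∈ T) :
    IsUnitOutside T (algebraMap k[X] (RatFunc k) p) :=
  fun α hα => valuation_poly_eq_one_iff.2 fun h0 => hα (h α h0)

theorem const {c : k} (hc : c ≠ 0) : IsUnitOutside T (algebraMap k (RatFunc k) c) := by
  rw [algebraMap_const]
  exact poly fun α h => absurd (by simpa using h) hc

theorem num_mem (hx : IsUnitOutside T x) {α : k} (h : x.num.eval α = 0) : α ∈ T := by
  by_contra hα
  exact (eval_num_denom_ne_zero (hx α hα)).1 h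

theorem denom_mem (hx : IsUnitOutside T x) {α : k} (h : x.denom.eval α = 0) : α ∈ T := by
  by_contra hα
  exact (eval_num_denom_ne_zero (hx α hα)).2 h

end IsUnitOutside

theorem exists_const_of_natDegree_eq_zero {x : RatFunc k} (h1 : x.num.natDegree = 0)
    (h2 : x.denom.natDegree = 0) : ∃ c : k, x = algebraMap k (RatFunc k) c := by
  obtain ⟨a, ha⟩ := natDegree_eq_zero.1 h1
  obtain ⟨b, hb⟩ := natDegree_eq_zero.1 h2
  refine ⟨a / b, ?_⟩
  rw [map_div₀, algebraMap_const, algebraMap_const, ha, hb, RatFunc.num_div_denom]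

/-- Equal logarithmic derivatives of numerator and denominator make their Wronskian vanish. By
coprimality both derivatives vanish, so both are constant in characteristic `0`. -/
theorem exists_const_of_logDeriv_eq [CharZero k] {R M : k[X]} (hR : R ≠ 0) {x : RatFunc k}
    (h1 : derivative x.num * R = x.num * M) (h2 : derivative x.denom * R = x.denom * M) :
    ∃ c : k, x = algebraMap k (RatFunc k) c := by
  have hw : wronskian x.num x.denom = 0 := by
    have : wronskian x.num x.denom * R = 0 := by
      rw [wronskian]; linear_combination x.num * h2 - x.denom * h1
    exact (mul_eq_zero.1 this).resolve_right hR
  obtain ⟨h3, h4⟩ := x.isCoprime_num_denom.wronskian_eq_zero_iff.1 hw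
  exact exists_const_of_natDegree_eq_zero (Polynomial.derivative_eq_zero.1 h3)
    (Polynomial.derivative_eq_zero.1 h4)

variable [IsAlgClosed k]

/-- The logarithmic derivative of a polynomial with all roots in `T` has denominator
`∏ α ∈ T, (X - α)`. -/
theorem exists_logDeriv {T : Finset k} {p : k[X]} (hp : p ≠ 0) (h : ∀ α, p.eval α = 0 → α ∈ T) :
    ∃ M : k[X], M.natDegree ≤ T.card ∧ derivative p * ∏ α ∈ T, (X - C α) = p * M := by
  classical
  have key : ∀ s : Multiset k, (∀ α ∈ s, α ∈ T) → ∃ M : k[X], M.natDegree ≤ T.card ∧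
      derivative (s.map fun α => X - C α).prod * ∏ α ∈ T, (X - C α) =
        (s.map fun α => X - C α).prod * M := by
    intro s
    induction s using Multiset.induction_on with
    | empty => exact fun _ => ⟨0, by simp, by simp⟩
    | cons a s ih =>
      intro hs
      obtain ⟨M, hM, hM'⟩ := ih fun α hα => hs α (Multiset.mem_cons_of_mem hα)
      have ha := hs a (Multiset.mem_cons_self a s)
      refine ⟨M + ∏ α ∈ T.erase a, (X - C α), ?_, ?_⟩
      · refine natDegree_add_le_of_degree_le hM ?_
        rw [natDegree_prod_of_monic _ _ fun α _ => monic_X_sub_C α]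
        simp [Finset.card_erase_of_mem ha]
      · rw [Multiset.map_cons, Multiset.prod_cons, derivative_mul, derivative_X_sub_C, add_mul,
          mul_assoc (X - C a), hM', ← Finset.mul_prod_erase T _ ha]
        ring
  obtain ⟨M, hM, hM'⟩ := key p.roots fun α hα => h α ((mem_roots hp).1 hα)
  refine ⟨M, hM, ?_⟩
  have hsplit := (IsAlgClosed.splits p).eq_prod_roots
  rw [hsplit, derivative_C_mul, mul_assoc, hM', ← mul_assoc]

/-- The divisor on the affine line determines a rational function up to a constant. -/
theorem exists_const_mul_of_count_eq {T : Finset k} {x y : RatFunc k} (hx : IsUnitOutside T x)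
    (hy : IsUnitOutside T y) (hx0 : x ≠ 0) (hy0 : y ≠ 0)
    (h : ∀ α ∈ T, rootMultiplicity α x.num = rootMultiplicity α y.num ∧
      rootMultiplicity α x.denom = rootMultiplicity α y.denom) :
    ∃ c : k, y = algebraMap k (RatFunc k) c * x := by
  classical
  have key : ∀ p q : k[X], p ≠ 0 → q ≠ 0 → (∀ α, p.eval α = 0 → α ∈ T) →
      (∀ α, q.eval α = 0 → α ∈ T) → (∀ α ∈ T, rootMultiplicity α p = rootMultiplicity α q) →
      q = C (q.leadingCoeff / p.leadingCoeff) * p := by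
    intro p q hp hq hpT hqT hpq
    have hroots : p.roots = q.roots := by
      ext α
      rw [count_roots, count_roots]
      by_cases hα : α ∈ T
      · exact hpq α hα
      · rw [rootMultiplicity_eq_zero (mt (hpT α) hα), rootMultiplicity_eq_zero (mt (hqT α) hα)]
    have h1 := (IsAlgClosed.splits p).eq_prod_roots
    have h2 := (IsAlgClosed.splits q).eq_prod_roots
    rw [← hroots] at h2
    calc q = C (q.leadingCoeff / p.leadingCoeff * p.leadingCoeff) *
          (p.roots.map fun α => X - C α).prod := by
          rw [div_mul_cancel₀ _ (leadingCoeff_ne_zero.2 hp)]; exact h2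
      _ = C (q.leadingCoeff / p.leadingCoeff) * p := by
          conv_rhs => enter [2]; rw [h1]
          rw [C_mul, mul_assoc]
  have h1 := key x.num y.num (RatFunc.num_ne_zero hx0) (RatFunc.num_ne_zero hy0)
    (fun α => hx.num_mem) (fun α => hy.num_mem) fun α hα => (h α hα).1
  have h2 := key x.denom y.denom x.denom_ne_zero y.denom_ne_zero
    (fun α => hx.denom_mem) (fun α => hy.denom_mem) fun α hα => (h α hα).2
  rw [(RatFunc.monic_denom x).leadingCoeff, (RatFunc.monic_denom y).leadingCoeff, div_one, C_1,
    one_mul] at h2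
  refine ⟨y.num.leadingCoeff / x.num.leadingCoeff, ?_⟩
  have e := (RatFunc.num_div_denom y).symm
  rwa [h2, h1, map_mul, mul_div_assoc, RatFunc.num_div_denom x, ← algebraMap_const] at e

variable [CharZero k]

theorem natDegree_radical_le [DecidableEq k] {T : Finset k} {p : k[X]}
    (h : ∀ α, p.eval α = 0 → α ∈ T) :
    (UniqueFactorizationMonoid.radical p).natDegree ≤ T.card := by
  set r := UniqueFactorizationMonoid.radical p
  have hr : r ≠ 0 := UniqueFactorizationMonoid.radical_ne_zero
  have hsep : r.Separable :=
    PerfectField.separable_iff_squarefree.2 UniqueFactorizationMonoid.squarefree_radical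
  rw [(IsAlgClosed.splits r).natDegree_eq_card_roots,
    ← Multiset.toFinset_card_of_nodup (nodup_roots hsep)]
  refine Finset.card_le_card fun α hα => h α ?_
  rw [Multiset.mem_toFinset, mem_roots hr] at hα
  exact hα.dvd UniqueFactorizationMonoid.radical_dvd_self

/-- Mason's theorem for `x + (1 - x) = 1`. -/
theorem heightLE_of_isUnitOutside {T : Finset k} {x : RatFunc k}
    (hx : IsUnitOutside T x) (hx' : IsUnitOutside T (1 - x)) : HeightLE T.card x := by
  classical
  by_cases hx0 : x = 0
  · rw [hx0]; simpa using HeightLE.const T.card (0 : k)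
  by_cases hx1 : x = 1
  · rw [hx1]; simpa using HeightLE.const T.card (1 : k)
  set p := x.num with hp
  set q := x.denom with hq
  have hp0 : p ≠ 0 := by rwa [hp, ne_eq, RatFunc.num_eq_zero_iff]
  have hq0 : q ≠ 0 := x.denom_ne_zero
  have hxpq : x = algebraMap k[X] (RatFunc k) p / algebraMap k[X] (RatFunc k) q :=
    (RatFunc.num_div_denom x).symm
  have hqK := RatFunc.algebraMap_ne_zero hq0
  have hsub : 1 - x = algebraMap k[X] (RatFunc k) (q - p) / algebraMap k[X] (RatFunc k) q := by
    rw [hxpq, map_sub, sub_div, div_self hqK]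
  have hqp0 : q - p ≠ 0 := by
    intro h
    rw [h, map_zero, zero_div, sub_eq_zero] at hsub
    exact hx1 hsub.symm
  have hroots : ∀ α, (p * -q * (q - p)).eval α = 0 → α ∈ T := by
    intro α h
    by_contra hα
    obtain ⟨h1, h2⟩ := eval_num_denom_ne_zero (hx α hα)
    have h3 := hx' α hα
    rw [hsub, map_div₀, valuation_poly_eq_one_iff.2 h2, div_one, valuation_poly_eq_one_iff] at h3
    rw [eval_mul, eval_mul, eval_neg] at h
    exact mul_ne_zero (mul_ne_zero h1 (neg_ne_zero.2 h2)) h3 h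
  have hdeg := natDegree_radical_le hroots
  -- Mason's theorem for `p + (-q) + (q - p) = 0`. In its exceptional case all derivatives vanish
  -- and `x` is constant.
  rcases Polynomial.abc hp0 (neg_ne_zero.2 hq0) hqp0 x.isCoprime_num_denom.neg_right (by ring) with
    h | h
  · rw [natDegree_neg] at h
    exact heightLE_num_denom (show p.natDegree ≤ _ by omega) (show q.natDegree ≤ _ by omega)
  · have h1 := Polynomial.derivative_eq_zero.1 h.1
    have h2 := Polynomial.derivative_eq_zero.1 h.2.1
    rw [natDegree_neg] at h2
    exact heightLE_num_denom (show p.natDegree ≤ _ by omega) (show q.natDegree ≤ _ by omega)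

/-- Differentiating `x₀ + x₁ + x₂ = 1` gives `∑ xᵢ Nᵢ = 0`, where `Nᵢ / R` is the logarithmic
derivative of `xᵢ` and `Nᵢ ≠ 0` has degree at most `#T`. Dividing by one term leaves a two-term
equation in units for `T` enlarged by the roots of the `Nᵢ`, to which Mason's theorem applies. -/
theorem heightLE_of_sum_three {T : Finset k} {x : Fin 3 → RatFunc k}
    (hx : ∀ i, IsUnitOutside T (x i)) (hx0 : ∀ i, x i ≠ 0) (hsum : x 0 + x 1 + x 2 = 1)
    (hc : ∀ i, ¬ ∃ c : k, x i = algebraMap k (RatFunc k) c) :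
    ∀ i, HeightLE (18 * T.card) (x i) := by
  classical
  set R : k[X] := ∏ α ∈ T, (X - C α) with hR
  have hR0 : R ≠ 0 := Finset.prod_ne_zero_iff.2 fun α _ => X_sub_C_ne_zero α
  have hnum : ∀ i, ∃ M : k[X], M.natDegree ≤ T.card ∧
      derivative (x i).num * R = (x i).num * M := fun i =>
    exists_logDeriv (RatFunc.num_ne_zero (hx0 i)) fun α h => (hx i).num_mem h
  have hden : ∀ i, ∃ M : k[X], M.natDegree ≤ T.card ∧
      derivative (x i).denom * R = (x i).denom * M := fun i =>
    exists_logDeriv (x i).denom_ne_zero fun α h => (hx i).denom_mem h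
  choose A hA hA' using hnum
  choose B hB hB' using hden
  set N : Fin 3 → k[X] := fun i => A i - B i with hN
  have hN0 : ∀ i, N i ≠ 0 := by
    intro i h
    refine hc i (exists_const_of_logDeriv_eq hR0 (hA' i) ?_)
    rw [sub_eq_zero.1 h]
    exact hB' i
  have hNdeg : ∀ i, (N i).natDegree ≤ T.card := fun i =>
    (natDegree_sub_le_of_le (hA i) (hB i)).trans_eq (max_self _)
  have hfrac : ∀ i, x i = algebraMap k[X] (RatFunc k) (x i).num / algebraMap _ _ (x i).denom :=
    fun i => (RatFunc.num_div_denom _).symm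
  have hd : ∀ i, algebraMap k[X] (RatFunc k) (x i).denom ≠ 0 := fun i =>
    RatFunc.algebraMap_ne_zero (x i).denom_ne_zero
  have hE : (x 0).num * (x 1).denom * (x 2).denom + (x 0).denom * (x 1).num * (x 2).denom +
      (x 0).denom * (x 1).denom * (x 2).num = (x 0).denom * (x 1).denom * (x 2).denom := by
    apply RatFunc.algebraMap_injective k
    have h0 := hd 0
    have h1 := hd 1
    have h2 := hd 2
    have := hsum
    rw [hfrac 0, hfrac 1, hfrac 2] at this
    field_simp at this
    simp only [map_add, map_mul]
    linear_combination this
  have hlin : (x 0).num * (x 1).denom * (x 2).denom * N 0 +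
      (x 0).denom * (x 1).num * (x 2).denom * N 1 +
      (x 0).denom * (x 1).denom * (x 2).num * N 2 = 0 := by
    have hE' := congrArg derivative hE
    simp only [derivative_add, derivative_mul] at hE'
    have a0 := hA' 0
    have a1 := hA' 1
    have a2 := hA' 2
    have b0 := hB' 0
    have b1 := hB' 1
    have b2 := hB' 2
    simp only [hN]
    generalize (x 0).num = n0 at *
    generalize (x 1).num = n1 at *
    generalize (x 2).num = n2 at *
    generalize (x 0).denom = d0 at *
    generalize (x 1).denom = d1 at *
    generalize (x 2).denom = d2 at *
    linear_combination R * hE' - (B 0 + B 1 + B 2) * hE - d1 * d2 * a0 - d0 * d2 * a1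
      - d0 * d1 * a2 - (n1 * d2 + d1 * n2 - d1 * d2) * b0 - (n0 * d2 + d0 * n2 - d0 * d2) * b1
      - (n0 * d1 + d0 * n1 - d0 * d1) * b2
  have hNK : ∀ i, algebraMap k[X] (RatFunc k) (N i) ≠ 0 := fun i =>
    RatFunc.algebraMap_ne_zero (hN0 i)
  have hlinK : x 0 * algebraMap k[X] (RatFunc k) (N 0) + x 1 * algebraMap k[X] (RatFunc k) (N 1) +
      x 2 * algebraMap k[X] (RatFunc k) (N 2) = 0 := by
    have h0 := hd 0
    have h1 := hd 1
    have h2 := hd 2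
    have := congrArg (algebraMap k[X] (RatFunc k)) hlin
    simp only [map_add, map_mul, map_zero] at this
    rw [hfrac 0, hfrac 1, hfrac 2]
    field_simp
    linear_combination this
  -- At most `#T` roots for each of the three `N i`, hence `4 * #T` in all.
  set T' : Finset k := T ∪ Finset.univ.biUnion fun i => (N i).roots.toFinset with hT'
  have hT'card : T'.card ≤ 4 * T.card := by
    refine (Finset.card_union_le _ _).trans ?_
    have : (Finset.univ.biUnion fun i => (N i).roots.toFinset).card ≤
        (Finset.univ : Finset (Fin 3)).card * T.card := by
      refine Finset.card_biUnion_le_card_mul _ _ _ fun i _ => ?_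
      exact (Multiset.toFinset_card_le _).trans ((card_roots' _).trans (hNdeg i))
    simp only [Finset.card_univ, Fintype.card_fin] at this
    omega
  have hNT' : ∀ i, IsUnitOutside T' (algebraMap k[X] (RatFunc k) (N i)) := by
    refine fun i => IsUnitOutside.poly fun α h => ?_
    rw [hT', Finset.mem_union, Finset.mem_biUnion]
    exact Or.inr ⟨i, Finset.mem_univ i, by rw [Multiset.mem_toFinset, mem_roots (hN0 i)]; exact h⟩
  have hxT' : ∀ i, IsUnitOutside T' (x i) := fun i => (hx i).mono Finset.subset_union_left
  set a : Fin 3 → RatFunc k := fun i =>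
    -((x i * algebraMap k[X] (RatFunc k) (N i)) / (x 2 * algebraMap k[X] (RatFunc k) (N 2))) with ha
  have haT' : ∀ i, IsUnitOutside T' (a i) := fun i =>
    (((hxT' i).mul (hNT' i)).div ((hxT' 2).mul (hNT' 2))).neg
  have hx2 := hx0 2
  have hN2 := hNK 2
  have ha01 : a 0 + a 1 = 1 := by
    simp only [ha]
    field_simp
    linear_combination -hlinK
  have ha0 : HeightLE (4 * T.card) (a 0) :=
    (heightLE_of_isUnitOutside (haT' 0) (by rw [← ha01, add_sub_cancel_left]; exact haT' 1)).mono
      hT'card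
  have ha1 : HeightLE (4 * T.card) (a 1) := by
    have := ha0.one_sub
    rwa [← ha01, add_sub_cancel_left] at this
  have hratio : ∀ i, HeightLE (4 * T.card) (a i) → HeightLE (6 * T.card) (x i / x 2) := by
    intro i h
    have : x i / x 2 = -(a i) * algebraMap k[X] (RatFunc k) (N 2) /
        algebraMap k[X] (RatFunc k) (N i) := by
      have := hNK i
      simp only [ha]
      field_simp
    rw [this]
    exact ((h.neg.mul (HeightLE.poly (hNdeg 2))).div (HeightLE.poly (hNdeg i))).mono (by omega)
  have hr0 := hratio 0 ha0
  have hr1 := hratio 1 ha1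
  -- The original equation recovers `x 2` from the ratios, as `1 / x₂ = 1 + x₀ / x₂ + x₁ / x₂`.
  have hh2 : HeightLE (12 * T.card) (x 2) := by
    have h1 := ((hr0.add hr1).neg).one_sub
    have h2 : x 2 = (1 - -(x 0 / x 2 + x 1 / x 2))⁻¹ := by
      have : 1 - -(x 0 / x 2 + x 1 / x 2) = (x 2)⁻¹ := by
        field_simp
        linear_combination hsum
      rw [this, inv_inv]
    rw [h2]
    exact h1.inv.mono (by omega)
  have hfin : ∀ i, HeightLE (6 * T.card) (x i / x 2) → HeightLE (18 * T.card) (x i) := by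
    intro i h
    have := h.mul hh2
    rw [div_mul_cancel₀ _ hx2] at this
    exact this.mono (by omega)
  intro i
  fin_cases i
  · exact hfin 0 hr0
  · exact hfin 1 hr1
  · exact hh2.mono (by omega)

/-- A bound for the number of non-constant `T`-units `x` for which `1 - x` has prescribed
valuations outside `T`, in terms of `t = #T`. -/
def unitBound (t : ℕ) : ℕ := ((18 * t + 1) ^ 4) ^ t + 2

/-- With `x₀` fixed and `μ = (1 - x) / (1 - x₀)`, each `x` solves the unit equation `x + μ - x₀ μ =
1`. This bounds the heights of `x` and `μ`, hence the number of possible divisors of the pair, and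
the pair of divisors determines `x`. -/
theorem card_le_unitBound {T : Finset k} {Λ : Finset (RatFunc k)}
    (hunit : ∀ x ∈ Λ, IsUnitOutside T x)
    (hconst : ∀ x ∈ Λ, ¬ ∃ c : k, x = algebraMap k (RatFunc k) c)
    (hratio : ∀ x ∈ Λ, ∀ y ∈ Λ, IsUnitOutside T ((1 - x) / (1 - y))) :
    Λ.card ≤ unitBound T.card := by
  classical
  rcases Λ.eq_empty_or_nonempty with rfl | ⟨x₀, hx₀⟩
  · simp
  have hne0 : ∀ x ∈ Λ, x ≠ 0 := fun x hx h => hconst x hx ⟨0, by rw [h, map_zero]⟩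
  have hne1 : ∀ x ∈ Λ, 1 - x ≠ 0 := fun x hx h =>
    hconst x hx ⟨1, by rw [map_one, sub_eq_zero.1 h]⟩
  set μ : RatFunc k → RatFunc k := fun x => (1 - x) / (1 - x₀) with hμ
  have h1x₀ := hne1 x₀ hx₀
  have hμ0 : ∀ x ∈ Λ, μ x ≠ 0 := fun x hx => div_ne_zero (hne1 x hx) h1x₀
  have hμeq : ∀ x, x + μ x * (1 - x₀) = 1 := by
    intro x; simp only [hμ]; field_simp; ring
  have hμunit : ∀ x ∈ Λ, IsUnitOutside T (μ x) := fun x hx => hratio x hx x₀ hx₀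
  -- If `μ` or `x₀ μ` is a constant `c`, the equation becomes, after scaling, a two-term one: `x + c
  -- x₀ * (-1) = 1 - c` or `x + μ = 1 + c`. The right side vanishes only for `x = x₀`, respectively
  -- `x = x₀⁻¹`; these two values are the `+ 2` in `unitBound`.
  have hheight : ∀ x ∈ Λ, x ≠ x₀ → x ≠ x₀⁻¹ →
      HeightLE (18 * T.card) x ∧ HeightLE (18 * T.card) (μ x) := by
    intro x hx hxx₀ hxinv
    by_cases hcμ : ∃ c : k, μ x = algebraMap k (RatFunc k) c
    · obtain ⟨c, hc⟩ := hcμ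
      have hc0 : c ≠ 0 := by rintro rfl; exact hμ0 x hx (by rw [hc, map_zero])
      have hc1 : 1 - c ≠ 0 := by
        intro h
        have hc1 : c = 1 := (sub_eq_zero.1 h).symm
        have := hμeq x
        rw [hc, hc1, map_one] at this
        exact hxx₀ (by linear_combination this)
      have hcK : algebraMap k (RatFunc k) (1 - c) ≠ 0 := by
        rwa [ne_eq, map_eq_zero]
      have e : 1 - x / algebraMap k (RatFunc k) (1 - c) =
          -(algebraMap k (RatFunc k) c * x₀) / algebraMap k (RatFunc k) (1 - c) := by
        field_simp
        have := hμeq x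
        rw [hc] at this
        rw [map_sub, map_one]
        linear_combination -this
      have h1 := heightLE_of_isUnitOutside ((hunit x hx).div (IsUnitOutside.const hc1))
        (by rw [e]; exact (((IsUnitOutside.const hc0).mul (hunit x₀ hx₀)).neg).div
              (IsUnitOutside.const hc1))
      have h2 := h1.mul (HeightLE.const 0 (1 - c))
      rw [div_mul_cancel₀ _ hcK] at h2
      exact ⟨h2.mono (by omega), hc ▸ HeightLE.const _ c⟩
    by_cases hcν : ∃ c : k, x₀ * μ x = algebraMap k (RatFunc k) c
    · obtain ⟨c, hc⟩ := hcν
      have hsum : x + μ x = algebraMap k (RatFunc k) (1 + c) := by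
        rw [map_add, map_one, ← hc]
        linear_combination hμeq x
      have hc1 : 1 + c ≠ 0 := by
        intro h
        apply hxinv
        have hc1 : c = -1 := by linear_combination h
        rw [h, map_zero] at hsum
        rw [hc1, map_neg, map_one] at hc
        refine eq_inv_of_mul_eq_one_left ?_
        linear_combination x₀ * hsum - hc
      have hcK : algebraMap k (RatFunc k) (1 + c) ≠ 0 := by
        rwa [ne_eq, map_eq_zero]
      have e : 1 - x / algebraMap k (RatFunc k) (1 + c) =
          μ x / algebraMap k (RatFunc k) (1 + c) := by
        field_simp
        linear_combination -hsum
      have h1 := heightLE_of_isUnitOutside ((hunit x hx).div (IsUnitOutside.const hc1))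
        (by rw [e]; exact (hμunit x hx).div (IsUnitOutside.const hc1))
      have h2 := h1.mul (HeightLE.const 0 (1 + c))
      rw [div_mul_cancel₀ _ hcK] at h2
      have h3 := (HeightLE.const 0 (1 + c)).add h2.neg
      rw [← hsum, ← sub_eq_add_neg, add_sub_cancel_left] at h3
      exact ⟨h2.mono (by omega), h3.mono (by omega)⟩
    have h := heightLE_of_sum_three (T := T) (x := ![x, μ x, -(x₀ * μ x)]) ?_ ?_ ?_ ?_
    · exact ⟨h 0, h 1⟩
    · intro i
      fin_cases i
      · exact hunit x hx
      · exact hμunit x hx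
      · exact ((hunit x₀ hx₀).mul (hμunit x hx)).neg
    · intro i
      fin_cases i
      · exact hne0 x hx
      · exact hμ0 x hx
      · exact neg_ne_zero.2 (mul_ne_zero (hne0 x₀ hx₀) (hμ0 x hx))
    · simp only [Matrix.cons_val]
      linear_combination hμeq x
    · intro i
      fin_cases i
      · exact hconst x hx
      · exact hcμ
      · rintro ⟨c, hc⟩
        refine hcν ⟨-c, ?_⟩
        rw [map_neg, ← hc]
        exact (neg_neg _).symm
  set Λ' := (Λ.erase x₀).erase x₀⁻¹ with hΛ'
  have hcard : Λ.card ≤ Λ'.card + 2 := by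
    have h1 : Λ.card - 1 ≤ (Λ.erase x₀).card := Finset.pred_card_le_card_erase
    have h2 : (Λ.erase x₀).card - 1 ≤ Λ'.card := Finset.pred_card_le_card_erase
    omega
  have hmem : ∀ x ∈ Λ', x ∈ Λ ∧ x ≠ x₀ ∧ x ≠ x₀⁻¹ := by
    intro x hx
    rw [hΛ', Finset.mem_erase, Finset.mem_erase] at hx
    exact ⟨hx.2.2, hx.2.1, hx.1⟩
  refine hcard.trans (Nat.add_le_add_right ?_ 2)
  set H := 18 * T.card with hH
  set box := Finset.range (H + 1) with hbox
  -- At each point of `T`, four multiplicities between `0` and `18 * #T`.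
  set F : RatFunc k → T → (ℕ × ℕ) × (ℕ × ℕ) := fun x α =>
    ((rootMultiplicity α.1 x.num, rootMultiplicity α.1 x.denom),
      (rootMultiplicity α.1 (μ x).num, rootMultiplicity α.1 (μ x).denom)) with hF
  have hmaps : ∀ x ∈ Λ', F x ∈ Fintype.piFinset fun _ : T => (box ×ˢ box) ×ˢ (box ×ˢ box) := by
    intro x hx
    obtain ⟨h1, h2, h3⟩ := hmem x hx
    obtain ⟨h4, h5⟩ := hheight x h1 h2 h3
    have hle : ∀ (p : k[X]) (α : k), p.natDegree ≤ H → rootMultiplicity α p ∈ box := by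
      intro p α hp
      rw [hbox, Finset.mem_range, Nat.lt_succ_iff, ← count_roots]
      exact (Multiset.count_le_card _ _).trans ((card_roots' p).trans hp)
    rw [Fintype.mem_piFinset]
    intro α
    simp only [hF, Finset.mem_product]
    exact ⟨⟨hle _ _ h4.natDegree_le.1, hle _ _ h4.natDegree_le.2⟩,
      hle _ _ h5.natDegree_le.1, hle _ _ h5.natDegree_le.2⟩
  have hinj : Set.InjOn F Λ' := by
    intro x hx y hy hxy
    have hx := (hmem x hx).1
    have hy := (hmem y hy).1
    have hxy' := fun α : T => congrFun hxy α
    simp only [hF, Prod.mk.injEq] at hxy'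
    obtain ⟨a, ha⟩ := exists_const_mul_of_count_eq (hunit x hx) (hunit y hy) (hne0 x hx)
      (hne0 y hy) fun α hα => (hxy' ⟨α, hα⟩).1
    obtain ⟨b, hb⟩ := exists_const_mul_of_count_eq (hμunit x hx) (hμunit y hy) (hμ0 x hx)
      (hμ0 y hy) fun α hα => (hxy' ⟨α, hα⟩).2
    have h1 := hμeq x
    have h2 := hμeq y
    rw [hb, ha] at h2
    -- Both `x + z = 1` and `a x + b z = 1` hold, with `z = μ x * (1 - x₀)`. If `a ≠ b`, solving for
    -- `x` gives a constant; if `a = b`, then `a = 1`.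
    by_cases hab : a - b = 0
    · have hb1 : b = 1 := by
        have : algebraMap k (RatFunc k) b = 1 := by
          rw [sub_eq_zero.1 hab] at h2
          linear_combination h2 - algebraMap k (RatFunc k) b * h1
        rwa [← map_one (algebraMap k (RatFunc k)), (algebraMap k (RatFunc k)).injective.eq_iff]
          at this
      rw [ha, sub_eq_zero.1 hab, hb1, map_one, one_mul]
    · exfalso
      refine hconst x hx ⟨(1 - b) / (a - b), ?_⟩
      have hK : algebraMap k (RatFunc k) (a - b) ≠ 0 := by
        rwa [ne_eq, map_eq_zero]
      rw [map_div₀, eq_div_iff hK, map_sub, map_sub, map_one]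
      linear_combination h2 - algebraMap k (RatFunc k) b * h1
  refine (Finset.card_le_card_of_injOn F hmaps hinj).trans ?_
  rw [Fintype.card_piFinset]
  simp only [Finset.prod_const, Finset.card_univ, Finset.card_product, hbox, Finset.card_range, Fintype.card_coe]
  exact le_of_eq (by ring)

end Units

/-! ### A criterion for isotriviality. -/

section Isotrivial

variable {k : Type*} [Field k]

theorem exists_poly_eval_eq_linear {K : Type*} [Field K] [Algebra k K] (ℓ : K →ₗ[k] k) {d : ℕ}
    {p : K[X]} (hp : p.natDegree ≤ d) :
    ∃ q : k[X], q.natDegree ≤ d ∧ (∀ i ≤ d, q.coeff i = ℓ (p.coeff i)) ∧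
      ∀ a : k, q.eval a = ℓ (p.eval (algebraMap k K a)) := by
  refine ⟨∑ i ∈ Finset.range (d + 1), monomial i (ℓ (p.coeff i)), ?_, ?_, ?_⟩
  · refine natDegree_sum_le_of_forall_le _ _ fun i hi => (natDegree_monomial_le _).trans ?_
    have := Finset.mem_range.1 hi
    omega
  · intro i hi
    rw [finsetSum_coeff, Finset.sum_eq_single i]
    · simp
    · intro j _ hj
      rw [coeff_monomial, if_neg hj]
    · intro h
      exact absurd (Finset.mem_range.2 (by omega)) h
  · intro a
    rw [eval_finsetSum, eval_eq_sum_range' (Nat.lt_succ_of_le hp), map_sum]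
    refine Finset.sum_congr rfl fun i _ => ?_
    rw [eval_monomial, ← map_pow, mul_comm (p.coeff i), ← Algebra.smul_def, map_smul, smul_eq_mul,
      mul_comm]

/-- A `k`-linear retraction `ℓ` of `k ⊆ k(t)`, applied to the coefficients of numerator and
denominator, preserves each relation `num(a) = b * denom(a)` with `a`, `b` constant. So `f / g`
agrees with `ψ` at more points than the two degrees allow unless they are equal. -/
theorem isDefinedOverConstants_of_eval {ψ : RatFunc (RatFunc k)} {W : Finset k}
    (hW : ∀ a ∈ W, ∃ b : k, toMap ψ (algebraMap k (RatFunc k) a : RatFunc k) =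
      ((algebraMap k (RatFunc k) b : RatFunc k) : OnePoint (RatFunc k)))
    (hcard : 2 * mapDegree ψ < W.card) : IsDefinedOverConstants ψ := by
  classical
  obtain ⟨ℓ, hℓ⟩ := LinearMap.exists_leftInverse_of_injective (Algebra.linearMap k (RatFunc k))
    (LinearMap.ker_eq_bot.2 (algebraMap k (RatFunc k)).injective)
  have hℓ1 : ℓ 1 = 1 := by
    have := LinearMap.congr_fun hℓ 1
    simpa using this
  have hn : ψ.num.natDegree ≤ mapDegree ψ := le_max_left _ _
  have hd : ψ.denom.natDegree ≤ mapDegree ψ := le_max_right _ _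
  obtain ⟨f, hf, -, hfe⟩ := exists_poly_eval_eq_linear ℓ hn
  obtain ⟨g, hg, hgc, hge⟩ := exists_poly_eval_eq_linear ℓ hd
  -- The denominator is monic and `ℓ 1 = 1`, so its leading coefficient survives.
  have hg0 : g ≠ 0 := by
    intro h
    have := hgc _ hd
    rw [(RatFunc.monic_denom ψ).coeff_natDegree, hℓ1, h, coeff_zero] at this
    exact zero_ne_one this
  set ι := algebraMap k (RatFunc k) with hι
  have hinj : Function.Injective ι := ι.injective
  have hzero : ψ.num * g.map ι - f.map ι * ψ.denom = 0 := by
    refine eq_zero_of_natDegree_lt_card_of_eval_eq_zero' _ (W.image ι) ?_ ?_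
    · intro x hx
      obtain ⟨a, ha, rfl⟩ := Finset.mem_image.1 hx
      obtain ⟨b, hb⟩ := hW a ha
      simp only [toMap, OnePoint.elim_some] at hb
      split_ifs at hb with h0
      · exact absurd hb (OnePoint.infty_ne_coe _)
      · rw [OnePoint.coe_eq_coe, div_eq_iff h0] at hb
        have h1 : f.eval a = b * g.eval a := by
          rw [hfe, hge, hb, hι, ← Algebra.smul_def, map_smul, smul_eq_mul]
        rw [eval_sub, eval_mul, eval_mul, eval_map_apply, eval_map_apply, h1, hb, map_mul]
        ring
    · rw [Finset.card_image_of_injective _ hinj]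
      refine lt_of_le_of_lt ((natDegree_sub_le _ _).trans (max_le ?_ ?_)) hcard
      · refine natDegree_mul_le.trans ?_
        rw [natDegree_map]
        omega
      · refine natDegree_mul_le.trans ?_
        rw [natDegree_map]
        omega
  refine ⟨f, g, hg0, ?_⟩
  have hgK : g.map ι ≠ 0 := (Polynomial.map_ne_zero_iff hinj).2 hg0
  conv_lhs => rw [← RatFunc.num_div_denom ψ]
  rw [div_eq_div_iff (RatFunc.algebraMap_ne_zero ψ.denom_ne_zero) (RatFunc.algebraMap_ne_zero hgK),
    ← map_mul, ← map_mul, sub_eq_zero.1 hzero]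

open Classical in
theorem isIsotrivialOver_of_const {φ : RatFunc (RatFunc k)} (A : GL (Fin 2) (RatFunc k))
    {Z : Finset (OnePoint (RatFunc k))}
    (hZ : ∀ P ∈ Z, ∃ a b : k, A • P = ((algebraMap k (RatFunc k) a : RatFunc k) : OnePoint _) ∧
      A • toMap φ P = ((algebraMap k (RatFunc k) b : RatFunc k) : OnePoint _))
    (hcard : 2 * mapDegree φ < Z.card) : IsIsotrivialOver φ := by
  have hR := (IsRep.gl A).comp ((IsRep.toMap φ).comp (IsRep.gl A⁻¹))
  rw [mul_one, one_mul] at hR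
  obtain ⟨P₀, hP₀⟩ : Z.Nonempty := Finset.card_pos.1 (by omega)
  -- The second form of the conjugate is not zero because `A • P₀` has a finite image.
  obtain ⟨ψ, hψ, hdeg⟩ := hR.exists_toMap_eq (by
    intro h0
    obtain ⟨a, b, -, hb⟩ := hZ P₀ hP₀
    have h1 := hR.apply_toPt (xc (A • P₀)) (yc (A • P₀)) (xc_ne_or_yc_ne _)
    rw [h0, toPt_xc_yc] at h1
    simp only [Function.comp_apply, inv_smul_smul] at h1
    rw [hb] at h1
    simp [homEval, toPt] at h1)
  refine ⟨A, ψ, fun P => by rw [hψ]; rfl, ?_⟩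
  choose! a b ha hb using hZ
  refine isDefinedOverConstants_of_eval (W := Z.image a) ?_ ?_
  · intro x hx
    obtain ⟨P, hP, rfl⟩ := Finset.mem_image.1 hx
    refine ⟨b P, ?_⟩
    rw [← ha P hP, ← hb P hP, hψ]
    simp
  · rw [Finset.card_image_of_injOn]
    · omega
    · intro P hP Q hQ h
      have := ha P hP
      rw [h, ← ha Q hQ] at this
      exact smul_left_cancel _ this

end Isotrivial

/-! ### Bounding symmetric configurations. -/

section Key

variable {k : Type*} [Field k] [IsAlgClosed k] [CharZero k]

/-- The bound for the number of points in a position that makes their cross-ratios with three given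
points `T`-units, for a non-isotrivial map of degree `d`. -/
def equidistantBound (d t : ℕ) : ℕ := 2 * unitBound t + 2 * d

/-- The distance conditions give the cross-ratio `c Q` valuation `1` and `1 - c Q` the valuation of
`δ A B / δ A C`, whatever `Q` is. So `card_le_unitBound` bounds the `P` with `c P` non-constant and
those with `c (φ P)` non-constant; the remaining `P` number at most `2 d` by non-isotriviality. -/
theorem card_le_of_equidistant {T : Finset k} {φ : RatFunc (RatFunc k)}
    (hiso : ¬ IsIsotrivialOver φ) {A B C : OnePoint (RatFunc k)} (hAB : A ≠ B) (hAC : A ≠ C)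
    (hBC : B ≠ C) {Z : Finset (OnePoint (RatFunc k))} (hinj : Set.InjOn (toMap φ) Z)
    (hne : ∀ P ∈ Z, ∀ Q, Q = P ∨ Q = toMap φ P → A ≠ Q ∧ B ≠ Q ∧ C ≠ Q)
    (hδ : ∀ α, α ∉ T → ∃ δ, IsAdapted ((linearPrime α).valuation (RatFunc k)) (toMap φ) δ ∧
      δ B C = δ A C ∧ ∀ P ∈ Z, ∀ Q, Q = P ∨ Q = toMap φ P → δ A Q = δ B Q ∧ δ C Q = δ B Q) :
    Z.card ≤ equidistantBound (mapDegree φ) T.card := by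
  classical
  set X : Finset (OnePoint (RatFunc k)) := Z ∪ Z.image (toMap φ) with hX
  have hXmem : ∀ Q ∈ X, ∃ P ∈ Z, Q = P ∨ Q = toMap φ P := by
    intro Q hQ
    rcases Finset.mem_union.1 hQ with h | h
    · exact ⟨Q, h, Or.inl rfl⟩
    · obtain ⟨P, hP, rfl⟩ := Finset.mem_image.1 h
      exact ⟨P, hP, Or.inr rfl⟩
  have hXne : ∀ Q ∈ X, A ≠ Q ∧ B ≠ Q ∧ C ≠ Q := fun Q hQ => by
    obtain ⟨P, hP, h⟩ := hXmem Q hQ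
    exact hne P hP Q h
  set c := crossRatio A B C with hc
  obtain ⟨g, hg⟩ := exists_smul_eq_crossRatio hAB hAC hBC
  have hcinj : Set.InjOn c X := by
    intro Q hQ Q' hQ' h
    have h1 := hg Q (hXne Q hQ).2.1.symm
    rw [← hc, h, hc, ← hg Q' (hXne Q' hQ').2.1.symm] at h1
    exact smul_left_cancel _ h1
  set IsC : OnePoint (RatFunc k) → Prop := fun Q => ∃ a : k, c Q = algebraMap k (RatFunc k) a
  have hunits : (X.filter fun Q => ¬ IsC Q).card ≤ unitBound T.card := by
    rw [← Finset.card_image_of_injOn (f := c) (hcinj.mono (Finset.filter_subset _ _))]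
    apply card_le_unitBound
    · intro x hx α hα
      obtain ⟨Q, hQ, rfl⟩ := Finset.mem_image.1 hx
      obtain ⟨P, hP, hPQ⟩ := hXmem Q (Finset.mem_filter.1 hQ).1
      obtain ⟨δ, had, h1, h2⟩ := hδ α hα
      have hBQ : δ B Q ≠ 0 := mt had.eq_zero_iff.1 (hne P hP Q hPQ).2.1
      have hAC' : δ A C ≠ 0 := mt had.eq_zero_iff.1 hAC
      rw [hc, had.val_crossRatio, h1, (h2 P hP Q hPQ).1, div_self (mul_ne_zero hBQ hAC')]
    · intro x hx
      obtain ⟨Q, hQ, rfl⟩ := Finset.mem_image.1 hx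
      exact (Finset.mem_filter.1 hQ).2
    · intro x hx y hy α hα
      obtain ⟨δ, had, -, h2⟩ := hδ α hα
      have key : ∀ z ∈ (X.filter fun Q => ¬ IsC Q).image c,
          (linearPrime α).valuation (RatFunc k) (1 - z) = δ A B / δ A C := by
        intro z hz
        obtain ⟨Q, hQ, rfl⟩ := Finset.mem_image.1 hz
        obtain ⟨P, hP, hPQ⟩ := hXmem Q (Finset.mem_filter.1 hQ).1
        have hBQ : δ B Q ≠ 0 := mt had.eq_zero_iff.1 (hne P hP Q hPQ).2.1
        rw [hc, had.val_one_sub_crossRatio (hne P hP Q hPQ).2.1 hAC, had.symm Q C,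
          (h2 P hP Q hPQ).2, mul_comm, mul_div_mul_left _ _ hBQ]
      rw [map_div₀, key x hx, key y hy, div_self]
      exact div_ne_zero (mt had.eq_zero_iff.1 hAB) (mt had.eq_zero_iff.1 hAC)
  have h1 : (Z.filter fun P => ¬ IsC P).card ≤ unitBound T.card :=
    (Finset.card_le_card (Finset.filter_subset_filter _ Finset.subset_union_left)).trans hunits
  have h2 : (Z.filter fun P => ¬ IsC (toMap φ P)).card ≤ unitBound T.card := by
    refine le_trans (Finset.card_le_card_of_injOn (toMap φ) ?_ ?_) hunits
    · intro P hP
      obtain ⟨h, h'⟩ := Finset.mem_filter.1 hP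
      exact Finset.mem_filter.2 ⟨Finset.mem_union_right _ (Finset.mem_image_of_mem _ h), h'⟩
    · exact hinj.mono (Finset.filter_subset _ _)
  have h3 : (Z.filter fun P => IsC P ∧ IsC (toMap φ P)).card ≤ 2 * mapDegree φ := by
    by_contra! h
    refine hiso (isIsotrivialOver_of_const g ?_ h)
    intro P hP
    obtain ⟨hPZ, ⟨a, ha⟩, ⟨b, hb⟩⟩ := Finset.mem_filter.1 hP
    refine ⟨a, b, ?_, ?_⟩
    · rw [hg P (hne P hPZ P (Or.inl rfl)).2.1.symm, ← hc, ha]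
    · rw [hg _ (hne P hPZ _ (Or.inr rfl)).2.1.symm, ← hc, hb]
  have hcover : Z ⊆ (Z.filter fun P => ¬ IsC P) ∪ (Z.filter fun P => ¬ IsC (toMap φ P)) ∪
      (Z.filter fun P => IsC P ∧ IsC (toMap φ P)) := by
    intro P hP
    simp only [Finset.mem_union, Finset.mem_filter, hP, true_and]
    tauto
  have h4 := (Finset.card_le_card hcover).trans ((Finset.card_union_le _ _).trans
    (Nat.add_le_add_right (Finset.card_union_le _ _) _))
  rw [equidistantBound]
  omega

end Key

/-! ### Periods of periodic points. -/

section Cycles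

/-- A step `M` and a modulus `N ∣ n` such that all `x` not divisible by `N` generate a subgroup of
`ℤ / n` that contains `M`. -/
theorem exists_step_modulus {n : ℕ} (hn : n ≠ 0) (h : ¬ n ∣ Nat.factorial 15) :
    ∃ M N : ℕ, 8 ≤ N ∧ N ∣ n ∧ ¬ n ∣ 2 * M ∧
      ∀ x : ℤ, ¬ (N : ℤ) ∣ x → ∃ u w : ℤ, (M : ℤ) = x * u + n * w := by
  rw [Nat.dvd_iff_prime_pow_dvd_dvd] at h
  push Not at h
  obtain ⟨q, a, hq, hqn, hq15⟩ := h
  -- Every number up to `15` divides `15!`, so the offending prime power is at least `16`.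
  have hq16 : 16 ≤ q ^ a := by
    by_contra! hlt
    exact hq15 (Nat.dvd_factorial (pow_pos hq.pos a) (by omega))
  obtain ⟨e, m, hqm, hnem⟩ := Nat.exists_eq_pow_mul_and_not_dvd hn q hq.ne_one
  have hae : a ≤ e := by
    have h1 : q ^ a ∣ q ^ e := by
      rw [hnem] at hqn
      exact ((Nat.Prime.coprime_iff_not_dvd hq).2 hqm).pow_left a |>.dvd_of_dvd_mul_right hqn
    exact (Nat.pow_dvd_pow_iff_le_right hq.one_lt).1 h1
  have hqe : 16 ≤ q ^ e := hq16.trans (Nat.pow_le_pow_right hq.pos hae)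
  have hm0 : m ≠ 0 := by rintro rfl; simp at hqm
  -- For odd `q` the full power `b = e` serves. For `q = 2` one factor is given up, so that twice
  -- the step `q ^ (b - 1) * m` is still not divisible by `n`; `2 ^ e ≥ 16` leaves `2 ^ b ≥ 8`.
  obtain ⟨b, hb1, hbe, hb8, h2⟩ : ∃ b, 1 ≤ b ∧ b ≤ e ∧ 8 ≤ q ^ b ∧ ¬ q ^ (e - b + 1) ∣ 2 := by
    by_cases hq2 : q = 2
    · subst hq2
      have he : 4 ≤ e := by
        by_contra! hlt
        have : 2 ^ e ≤ 2 ^ 3 := Nat.pow_le_pow_right (by norm_num) (by omega)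
        omega
      refine ⟨e - 1, by omega, by omega, ?_, ?_⟩
      · calc 8 = 2 ^ 3 := by norm_num
          _ ≤ 2 ^ (e - 1) := Nat.pow_le_pow_right (by norm_num) (by omega)
      · rw [show e - (e - 1) + 1 = 2 by omega]
        norm_num
    · have he : 1 ≤ e := by
        by_contra! hlt
        rw [Nat.lt_one_iff.1 hlt] at hqe
        norm_num at hqe
      refine ⟨e, he, le_rfl, by omega, ?_⟩
      rw [Nat.sub_self, zero_add, pow_one, Nat.prime_dvd_prime_iff_eq hq Nat.prime_two]
      exact hq2
  refine ⟨q ^ (b - 1) * m, q ^ b, hb8, ?_, ?_, ?_⟩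
  · rw [hnem]
    exact (pow_dvd_pow q hbe).mul_right m
  · intro hdvd
    apply h2
    rw [hnem, show q ^ e = q ^ (b - 1) * q ^ (e - b + 1) by rw [← pow_add]; congr 1; omega,
      show 2 * (q ^ (b - 1) * m) = q ^ (b - 1) * (2 * m) by ring, mul_assoc] at hdvd
    have := (Nat.mul_dvd_mul_iff_left (pow_pos hq.pos _)).1 hdvd
    exact (Nat.mul_dvd_mul_iff_right (Nat.pos_of_ne_zero hm0)).1 this
  · intro x hx
    -- Since `q ^ b` does not divide `x`, the `q`-part of the gcd is at most `q ^ (b - 1)`, and the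
    -- rest divides `m`.
    have hg : x.gcd n ∣ q ^ (b - 1) * m := by
      have h1 : x.gcd n ∣ q ^ e * m := by
        rw [← hnem]; exact Int.gcd_dvd_natAbs_right x n
      obtain ⟨g₁, g₂, hg₁, hg₂, hgg⟩ := (Nat.dvd_mul).1 h1
      obtain ⟨i, hi, rfl⟩ := (Nat.dvd_prime_pow hq).1 hg₁
      have hib : i ≤ b - 1 := by
        by_contra! hlt
        apply hx
        have h2 : q ^ b ∣ x.gcd n := by
          rw [← hgg]
          exact (pow_dvd_pow q (by omega)).mul_right g₂
        exact (Int.natCast_dvd_natCast.2 h2).trans (Int.gcd_dvd_left x n)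
      rw [← hgg]
      exact mul_dvd_mul (pow_dvd_pow q hib) hg₂
    obtain ⟨r, hr⟩ := hg
    refine ⟨x.gcdA n * r, x.gcdB n * r, ?_⟩
    rw [hr, Nat.cast_mul, Int.gcd_eq_gcd_ab]
    ring

theorem card_filter_dvd_le {n N : ℕ} (hNn : N ∣ n) (c : ℤ) :
    ((Finset.range n).filter fun j : ℕ => (N : ℤ) ∣ j + c).card ≤ n / N := by
  rw [← Finset.card_range (n / N)]
  refine Finset.card_le_card_of_injOn (fun j => j / N) ?_ ?_
  · intro j hj
    have := Finset.mem_range.1 (Finset.mem_filter.1 hj).1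
    exact Finset.mem_coe.2 (Finset.mem_range.2 (Nat.div_lt_div_of_lt_of_dvd hNn this))
  · intro i hi j hj hij
    have h1 := (Finset.mem_filter.1 hi).2
    have h2 := (Finset.mem_filter.1 hj).2
    have h3 : (N : ℤ) ∣ (j : ℤ) - i := by
      have := dvd_sub h2 h1
      rwa [add_sub_add_right_eq_sub] at this
    have h4 : i % N = j % N := (Nat.modEq_iff_dvd.2 h3)
    rw [← Nat.div_add_mod i N, ← Nat.div_add_mod j N, h4]
    simp only at hij
    rw [hij]

/-- Each of the six residue classes takes at most an eighth of the range, which leaves a quarter. -/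
theorem card_filter_avoid {n N : ℕ} (hN : 8 ≤ N) (hNn : N ∣ n) (c : Fin 6 → ℤ) :
    n ≤ 4 * ((Finset.range n).filter fun j : ℕ => ∀ i, ¬ (N : ℤ) ∣ j + c i).card := by
  classical
  have hcover : Finset.range n ⊆
      ((Finset.range n).filter fun j : ℕ => ∀ i, ¬ (N : ℤ) ∣ j + c i) ∪
      Finset.univ.biUnion fun i => (Finset.range n).filter fun j : ℕ => (N : ℤ) ∣ j + c i := by
    intro j hj
    simp only [Finset.mem_union, Finset.mem_filter, Finset.mem_biUnion, hj, true_and,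
      Finset.mem_univ]
    by_cases h : ∀ i, ¬ (N : ℤ) ∣ j + c i
    · exact Or.inl h
    · push Not at h
      exact Or.inr h
  have h1 := (Finset.card_le_card hcover).trans (Finset.card_union_le _ _)
  have h2 : (Finset.univ.biUnion fun i => (Finset.range n).filter
      fun j : ℕ => (N : ℤ) ∣ j + c i).card ≤ (Finset.univ : Finset (Fin 6)).card * (n / N) :=
    Finset.card_biUnion_le_card_mul _ _ _ fun i _ => card_filter_dvd_le hNn (c i)
  have h3 : 8 * (n / N) ≤ n :=
    (Nat.mul_le_mul_right _ hN).trans (Nat.mul_div_le n N)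
  rw [Finset.card_range] at h1
  rw [Finset.card_univ, Fintype.card_fin] at h2
  omega

variable {Γ : Type*} [LinearOrderedCommGroupWithZero Γ]

/-- An ultrametric function on `ℤ` vanishing at `n` takes at `x` at least its value at
any `M ∈ ⟨x, n⟩`. -/
theorem ultrametric_le {f : ℤ → Γ} (h0 : f 0 = 0) (hneg : ∀ x, f (-x) = f x)
    (hadd : ∀ x y, f (x + y) ≤ max (f x) (f y)) {n : ℤ} (hn : f n = 0) {M x : ℤ}
    (h : ∃ u w : ℤ, M = x * u + n * w) : f M ≤ f x := by
  let H : AddSubgroup ℤ :=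
    { carrier := {z | f z ≤ f x}
      add_mem' := fun {a b} ha hb => (hadd a b).trans (max_le ha hb)
      zero_mem' := by
        change f 0 ≤ f x
        rw [h0]
        exact zero_le
      neg_mem' := fun {a} ha => by
        change f (-a) ≤ f x
        rw [hneg]
        exact ha }
  obtain ⟨u, w, rfl⟩ := h
  have hx : x ∈ H := le_refl (f x)
  have hnH : n ∈ H := by
    change f n ≤ f x
    rw [hn]
    exact zero_le
  have h1 : x * u ∈ H := by
    rw [mul_comm, ← smul_eq_mul]
    exact H.zsmul_mem hx u
  have h2 : n * w ∈ H := by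
    rw [mul_comm, ← smul_eq_mul]
    exact H.zsmul_mem hnH w
  exact H.add_mem h1 h2

/-- A periodic orbit, indexed by the integers. -/
theorem exists_int_orbit {X : Type*} {F : X → X} {P : X} (hP : 0 < Function.minimalPeriod F P) :
    ∃ p : ℤ → X, (∀ i, p (i + 1) = F (p i)) ∧
      ∀ i j, p i = p j ↔ (Function.minimalPeriod F P : ℤ) ∣ j - i := by
  set n := Function.minimalPeriod F P with hn
  have hn0 : (n : ℤ) ≠ 0 := by exact_mod_cast hP.ne'
  have hcast : ∀ i : ℤ, (((i % n).toNat : ℕ) : ℤ) = i % n := fun i =>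
    Int.toNat_of_nonneg (Int.emod_nonneg _ hn0)
  have hlt : ∀ i : ℤ, (i % n).toNat < n := fun i => by
    have := Int.emod_lt_of_pos i (by exact_mod_cast hP : (0 : ℤ) < n)
    have := hcast i
    omega
  refine ⟨fun i => F^[(i % n).toNat] P, fun i => ?_, fun i j => ?_⟩
  · rw [← Function.iterate_succ_apply' F, ← Function.iterate_mod_minimalPeriod_eq (n := _ + 1)]
    have e : ((i + 1) % n).toNat = ((i % n).toNat + 1) % n := by
      zify
      rw [hcast, hcast]
      simp
    simp only [e, ← hn]
  · constructor
    · intro h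
      have h1 := Function.iterate_injOn_Iio_minimalPeriod (hlt i) (hlt j) h
      have h2 : i % n = j % n := by rw [← hcast i, ← hcast j, h1]
      exact (Int.modEq_iff_dvd).1 h2
    · intro h
      have h2 : i % n = j % n := Int.modEq_iff_dvd.2 h
      simp only [h2]

variable {k : Type*} [Field k] [IsAlgClosed k] [CharZero k]

/-- Going once around the cycle shows that `φ` preserves distances on it, so they are values of an
ultrametric function `f` of the index difference. With `M` and `N` from `exists_step_modulus`, `f M`
is at most `f x` for all `x` not divisible by `N`, so a shift by `M` between two such `x` does not
change `f`. The base points are those of index `M`, `-M` and `0`. -/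
theorem minimalPeriod_le {T : Finset k} {φ : RatFunc (RatFunc k)} (hiso : ¬ IsIsotrivialOver φ)
    (hgood : ∀ α, α ∉ T →
      ∃ δ, IsAdapted ((linearPrime α).valuation (RatFunc k)) (toMap φ) δ)
    (P : OnePoint (RatFunc k)) :
    Function.minimalPeriod (toMap φ) P ≤
      Nat.factorial 15 + 4 * equidistantBound (mapDegree φ) T.card := by
  classical
  rcases Nat.eq_zero_or_pos (Function.minimalPeriod (toMap φ) P) with h0 | hpos
  · omega
  obtain ⟨p, hp1, hpeq⟩ := exists_int_orbit hpos
  set n := Function.minimalPeriod (toMap φ) P with hn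
  by_cases hdvd : n ∣ Nat.factorial 15
  · have := Nat.le_of_dvd (Nat.factorial_pos _) hdvd
    omega
  obtain ⟨M, N, hN8, hNn, h2M, hMN⟩ := exists_step_modulus hpos.ne' hdvd
  have hNn' : (N : ℤ) ∣ n := Int.natCast_dvd_natCast.2 hNn
  have h2M' : ¬ (n : ℤ) ∣ 2 * M := by
    intro h
    exact h2M (by exact_mod_cast h)
  have hM' : ¬ (n : ℤ) ∣ M := fun h => h2M' (h.mul_left 2)
  -- Both `j` and its successor, the index of the image point, must avoid `0` and `±M` modulo `N`.
  set c : Fin 6 → ℤ := ![0, M, -M, 1, 1 + M, 1 - M] with hc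
  set J := (Finset.range n).filter fun j : ℕ => ∀ i, ¬ (N : ℤ) ∣ j + c i with hJ
  have hJcard : n ≤ 4 * J.card := card_filter_avoid hN8 hNn c
  have hJmem : ∀ j ∈ J, ∀ x : ℤ, x = j ∨ x = j + 1 →
      ¬ (N : ℤ) ∣ x ∧ ¬ (N : ℤ) ∣ x + M ∧ ¬ (N : ℤ) ∣ x - M := by
    intro j hj x hx
    have h := (Finset.mem_filter.1 hj).2
    have h0 := h 0
    have h1 := h 1
    have h2 := h 2
    have h3 := h 3
    have h4 := h 4
    have h5 := h 5
    simp only [hc, Matrix.cons_val] at h0 h1 h2 h3 h4 h5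
    rcases hx with rfl | rfl
    · exact ⟨by simpa using h0, h1, by rwa [sub_eq_add_neg]⟩
    · exact ⟨h3, by rwa [add_assoc], by rwa [add_sub_assoc]⟩
  have hpinj : Set.InjOn (fun j : ℕ => p j) J := by
    intro i hi j hj h
    have hi := Finset.mem_range.1 (Finset.mem_filter.1 hi).1
    have hj := Finset.mem_range.1 (Finset.mem_filter.1 hj).1
    have h1 := (hpeq i j).1 h
    have h2 := Int.eq_zero_of_abs_lt_dvd h1 (by rw [abs_lt]; omega)
    omega
  have hZ : (J.image fun j : ℕ => p j).card ≤ equidistantBound (mapDegree φ) T.card := by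
    have hmem : ∀ R ∈ J.image (fun j : ℕ => p j), ∀ Q, Q = R ∨ Q = toMap φ R →
        ∃ x : ℤ, Q = p x ∧ ¬ (N : ℤ) ∣ x ∧ ¬ (N : ℤ) ∣ x + M ∧ ¬ (N : ℤ) ∣ x - M := by
      intro R hR Q hQ
      obtain ⟨j, hj, rfl⟩ := Finset.mem_image.1 hR
      rcases hQ with rfl | rfl
      · exact ⟨j, rfl, hJmem j hj j (Or.inl rfl)⟩
      · exact ⟨j + 1, (hp1 j).symm, hJmem j hj (j + 1) (Or.inr rfl)⟩
    refine card_le_of_equidistant hiso (A := p M) (B := p (-M)) (C := p 0) ?_ ?_ ?_ ?_ ?_ ?_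
    · rw [ne_eq, hpeq]
      intro h
      apply h2M'
      rwa [← dvd_neg, show -(2 * (M : ℤ)) = -M - M by ring]
    · rw [ne_eq, hpeq, zero_sub, dvd_neg]
      exact hM'
    · rw [ne_eq, hpeq, zero_sub, neg_neg]
      exact hM'
    · intro R hR R' hR' h
      obtain ⟨i, hi, rfl⟩ := Finset.mem_image.1 hR
      obtain ⟨j, hj, rfl⟩ := Finset.mem_image.1 hR'
      rw [← hp1, ← hp1, hpeq, add_sub_add_right_eq_sub] at h
      exact (hpeq _ _).2 h
    · intro R hR Q hQ
      obtain ⟨x, rfl, h1, h2, h3⟩ := hmem R hR Q hQ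
      simp only [ne_eq, hpeq]
      exact ⟨fun h => h3 (hNn'.trans h), fun h => h2 (hNn'.trans (by simpa using h)),
        fun h => h1 (hNn'.trans (by simpa using h))⟩
    · intro α hα
      obtain ⟨δ, had⟩ := hgood α hα
      refine ⟨δ, had, ?_⟩
      have hshift1 : ∀ i j, δ (p (i + 1)) (p (j + 1)) ≤ δ (p i) (p j) := by
        intro i j
        rw [hp1, hp1]
        exact had.map_le _ _
      have hshift : ∀ (m : ℕ) (i j : ℤ), δ (p (i + m)) (p (j + m)) ≤ δ (p i) (p j) := by
        intro m
        induction m with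
        | zero => intro i j; simp
        | succ m ih =>
          intro i j
          push_cast
          rw [← add_assoc, ← add_assoc]
          exact (hshift1 _ _).trans (ih i j)
      have hper : ∀ i m : ℤ, p (i + n * m) = p i := by
        intro i m
        rw [hpeq]
        exact ⟨-m, by ring⟩
      -- A backward shift is a forward one up to a multiple of `n`, so the inequality holds in both
      -- directions.
      have hshiftZ : ∀ m i j : ℤ, δ (p (i + m)) (p (j + m)) ≤ δ (p i) (p j) := by
        intro m i j
        have h1 := hshift (m + n * |m|).toNat i j
        have h2 : 0 ≤ m + n * |m| := by
          have h3 := neg_abs_le m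
          have h4 : |m| ≤ n * |m| := le_mul_of_one_le_left (abs_nonneg m) (by exact_mod_cast hpos)
          omega
        rw [Int.toNat_of_nonneg h2, ← add_assoc, ← add_assoc, hper, hper] at h1
        exact h1
      have hdiff : ∀ i j, δ (p i) (p j) = δ (p 0) (p (j - i)) := by
        intro i j
        apply le_antisymm
        · have := hshiftZ i 0 (j - i)
          rwa [zero_add, sub_add_cancel] at this
        · have := hshiftZ (-i) i j
          rwa [add_neg_cancel, ← sub_eq_add_neg] at this
      set f : ℤ → _ := fun x => δ (p 0) (p x) with hf
      have hf0 : f 0 = 0 := had.eq_zero_iff.2 rfl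
      have hfneg : ∀ x, f (-x) = f x := by
        intro x
        simp only [hf]
        rw [had.symm, hdiff, zero_sub, neg_neg]
      have hfadd : ∀ x y, f (x + y) ≤ max (f x) (f y) := by
        intro x y
        have := had.le_max (p 0) (p x) (p (x + y))
        rwa [hdiff x, add_sub_cancel_left] at this
      have hfn : f n = 0 := had.eq_zero_iff.2 ((hpeq _ _).2 (by simp))
      have hstep : ∀ x, ¬ (N : ℤ) ∣ x → ¬ (N : ℤ) ∣ x + M → f x = f (x + M) := by
        intro x h1 h2
        have h3 := ultrametric_le hf0 hfneg hfadd hfn (hMN x h1)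
        have h4 := ultrametric_le hf0 hfneg hfadd hfn (hMN _ h2)
        apply le_antisymm
        · have := hfadd (x + M) (-M)
          rw [add_neg_cancel_right, hfneg] at this
          exact this.trans (max_le le_rfl h4)
        · exact (hfadd x M).trans (max_le le_rfl h3)
      refine ⟨?_, ?_⟩
      · rw [hdiff (-(M : ℤ)) 0, hdiff (M : ℤ) 0, zero_sub, zero_sub, neg_neg]
        exact (hfneg M).symm
      · intro R hR Q hQ
        obtain ⟨x, rfl, h1, h2, h3⟩ := hmem R hR Q hQ
        rw [hdiff (M : ℤ) x, hdiff (-(M : ℤ)) x, sub_neg_eq_add]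
        change f (x - M) = f (x + M) ∧ f x = f (x + M)
        have h4 := hstep x h1 h2
        have h5 := hstep (x - M) h3 (by rwa [sub_add_cancel])
        rw [sub_add_cancel] at h5
        exact ⟨h5.trans h4, h4⟩
  rw [Finset.card_image_of_injOn hpinj] at hZ
  omega

end Cycles

/-! ### Length of the preperiod. -/

section Tails

variable {k : Type*} [Field k] [IsAlgClosed k] [CharZero k]

/-- Walking back from the cycle, a tail point only moves away from the cycle point of the same
phase. For `n ∣ i` that cycle point is `q 0`, so `q i` is no farther from `q 0` than any earlier
point of the orbit is, and the ultrametric inequality gives the equality. -/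
theorem tail_dist {Γ : Type*} [LinearOrderedCommGroupWithZero Γ] {K : Type*} [Field K]
    {v : Valuation K Γ} {F : OnePoint K → OnePoint K} {δ : OnePoint K → OnePoint K → Γ}
    (had : IsAdapted v F δ) {q : ℕ → OnePoint K} {m n : ℕ} (hn : 0 < n)
    (hq : ∀ j < m, F (q (j + 1)) = q j) (hper : F^[n] (q 0) = q 0) {i j : ℕ} (hi : n ∣ i)
    (hij : 2 * i ≤ j) (hj : j ≤ m) : δ (q j) (q i) = δ (q j) (q 0) := by
  have hiter : ∀ (l : ℕ) (P Q : OnePoint K), δ (F^[l] P) (F^[l] Q) ≤ δ P Q := by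
    intro l
    induction l with
    | zero => exact fun P Q => le_rfl
    | succ l ih =>
      intro P Q
      rw [Function.iterate_succ_apply', Function.iterate_succ_apply']
      exact (had.map_le _ _).trans (ih P Q)
  have hdesc : ∀ a b : ℕ, a + b ≤ m → F^[a] (q (a + b)) = q b := by
    intro a
    induction a with
    | zero => intro b _; simp
    | succ a ih =>
      intro b h
      rw [Function.iterate_succ_apply, show a + 1 + b = (a + b) + 1 by ring, hq _ (by omega),
        ih b (by omega)]
  have hper' : ∀ a, F^[n * a] (q 0) = q 0 := fun a =>
    (Function.IsPeriodicPt.mul_const (show Function.IsPeriodicPt F n (q 0) from hper) a)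
  -- On the cycle, `n - 1` steps forward are one step back, so the second argument is the cycle
  -- point `l` steps before `q 0`.
  set a : ℕ → Γ := fun l => δ (q l) (F^[l * (n - 1)] (q 0)) with ha
  have ha_succ : ∀ l < m, a l ≤ a (l + 1) := by
    intro l hl
    have h1 := had.map_le (q (l + 1)) (F^[(l + 1) * (n - 1)] (q 0))
    rw [hq l hl, ← Function.iterate_succ_apply' F,
      show ((l + 1) * (n - 1)).succ = l * (n - 1) + n by
        obtain ⟨n, rfl⟩ : ∃ r, n = r + 1 := ⟨n - 1, by omega⟩
        rw [Nat.add_sub_cancel, Nat.succ_eq_add_one]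
        ring, Function.iterate_add_apply, hper] at h1
    exact h1
  have ha_mono : ∀ l l', l ≤ l' → l' ≤ m → a l ≤ a l' := by
    intro l l' h
    induction l', h using Nat.le_induction with
    | base => exact fun _ => le_rfl
    | succ l' h ih => exact fun hm => (ih (by omega)).trans (ha_succ l' (by omega))
  have ha_le : ∀ l ≤ m, a l ≤ δ (q l) (q 0) := by
    intro l hl
    refine (had.le_max (q l) (q 0) _).trans (max_le le_rfl ?_)
    -- The iterate `F^[n * l]` fixes `q 0` and carries `q l` to the cycle point of its phase.
    have h1 := hiter (n * l) (q l) (q 0)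
    rw [hper', show n * l = l * (n - 1) + l by
        obtain ⟨n, rfl⟩ : ∃ r, n = r + 1 := ⟨n - 1, by omega⟩
        rw [Nat.add_sub_cancel]
        ring, Function.iterate_add_apply, show F^[l] (q l) = q 0 from hdesc l 0 (by omega)] at h1
    rwa [had.symm]
  have hd_mono : ∀ l, i ≤ l → l ≤ m → δ (q i) (q 0) ≤ δ (q l) (q 0) := by
    intro l h1 h2
    obtain ⟨r, rfl⟩ := hi
    have h3 : a (n * r) = δ (q (n * r)) (q 0) := by
      simp only [ha]
      rw [mul_assoc, hper']
    rw [← h3]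
    exact (ha_mono _ _ h1 h2).trans (ha_le l h2)
  -- Apply `F^[i]` to the pair `q j`, `q i`; `2 * i ≤ j` ensures that `j - i` is still at least `i`.
  have h1 : δ (q i) (q 0) ≤ δ (q j) (q i) := by
    have h2 := hiter i (q j) (q i)
    rw [show F^[i] (q i) = q 0 from hdesc i 0 (by omega), show j = i + (j - i) by omega,
      hdesc i (j - i) (by omega), ← show j = i + (j - i) by omega] at h2
    exact (hd_mono (j - i) (by omega) (by omega)).trans h2
  apply le_antisymm
  · have h2 := had.le_max (q j) (q 0) (q i)
    rw [had.symm (q 0)] at h2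
    exact h2.trans (max_le le_rfl (hd_mono j (by omega) hj))
  · exact (had.le_max (q j) (q i) (q 0)).trans (max_le le_rfl h1)

/-- By `tail_dist`, the base points `q 0`, `q n` and `q (2 * n)` have the same distance to every `q
j` with `j ≥ 4 * n`. -/
theorem tail_length_le {T : Finset k} {φ : RatFunc (RatFunc k)} (hiso : ¬ IsIsotrivialOver φ)
    (hgood : ∀ α, α ∉ T →
      ∃ δ, IsAdapted ((linearPrime α).valuation (RatFunc k)) (toMap φ) δ)
    {R : OnePoint (RatFunc k)} {m n : ℕ} (hn : 0 < n)
    (hper : (toMap φ)^[n] ((toMap φ)^[m] R) = (toMap φ)^[m] R)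
    (hmin : ∀ l < m, (toMap φ)^[l] R ∉ Function.periodicPts (toMap φ)) :
    m ≤ 4 * n + equidistantBound (mapDegree φ) T.card := by
  classical
  set F := toMap φ with hF
  set q : ℕ → OnePoint (RatFunc k) := fun j => F^[m - j] R with hq
  have hqs : ∀ j < m, F (q (j + 1)) = q j := by
    intro j hj
    simp only [hq]
    rw [← Function.iterate_succ_apply' F]
    congr 2
    omega
  have hq0 : F^[n] (q 0) = q 0 := hper
  have hqne : ∀ i j, i < j → j ≤ m → q i ≠ q j := by
    intro i j hij hj h
    refine hmin (m - j) (by omega) ⟨j - i, by omega, ?_⟩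
    change F^[j - i] (F^[m - j] R) = F^[m - j] R
    rw [← Function.iterate_add_apply, show j - i + (m - j) = m - i by omega]
    exact h
  by_contra! hlt
  -- The range starts at `4 * n + 1` because the image of `q j` is `q (j - 1)`.
  set Z := (Finset.Icc (4 * n + 1) m).image q with hZ
  have hinj : Set.InjOn q (Finset.Icc (4 * n + 1) m) := by
    intro i hi j hj h
    have hi := Finset.mem_Icc.1 hi
    have hj := Finset.mem_Icc.1 hj
    rcases lt_trichotomy i j with h1 | h1 | h1
    · exact absurd h (hqne i j h1 hj.2)
    · exact h1
    · exact absurd h.symm (hqne j i h1 hi.2)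
  have hmem : ∀ P ∈ Z, ∀ Q, Q = P ∨ Q = F P → ∃ j, 4 * n ≤ j ∧ j ≤ m ∧ Q = q j := by
    intro P hP Q hQ
    obtain ⟨j, hj, rfl⟩ := Finset.mem_image.1 hP
    have hj := Finset.mem_Icc.1 hj
    rcases hQ with rfl | rfl
    · exact ⟨j, by omega, hj.2, rfl⟩
    · refine ⟨j - 1, by omega, by omega, ?_⟩
      have := hqs (j - 1) (by omega)
      rwa [Nat.sub_add_cancel (by omega)] at this
  have hcard : Z.card ≤ equidistantBound (mapDegree φ) T.card := by
    refine card_le_of_equidistant hiso (A := q 0) (B := q n) (C := q (2 * n))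
      (hqne _ _ hn (by omega)) (hqne _ _ (by omega) (by omega)) (hqne _ _ (by omega) (by omega))
      ?_ ?_ ?_
    · intro P hP P' hP' h
      obtain ⟨i, hi, rfl⟩ := Finset.mem_image.1 hP
      obtain ⟨j, hj, rfl⟩ := Finset.mem_image.1 hP'
      have hi := Finset.mem_Icc.1 hi
      have hj := Finset.mem_Icc.1 hj
      have e1 := hqs (i - 1) (by omega)
      have e2 := hqs (j - 1) (by omega)
      rw [Nat.sub_add_cancel (by omega)] at e1 e2
      rw [← hF, e1, e2] at h
      rcases lt_trichotomy i j with h1 | h1 | h1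
      · exact absurd h (hqne (i - 1) (j - 1) (by omega) (by omega))
      · rw [h1]
      · exact absurd h.symm (hqne (j - 1) (i - 1) (by omega) (by omega))
    · intro P hP Q hQ
      obtain ⟨j, h1, h2, rfl⟩ := hmem P hP Q hQ
      exact ⟨hqne _ _ (by omega) h2, hqne _ _ (by omega) h2, hqne _ _ (by omega) h2⟩
    · intro α hα
      obtain ⟨δ, had⟩ := hgood α hα
      have hd : ∀ r j, 2 * (n * r) ≤ j → j ≤ m → δ (q (n * r)) (q j) = δ (q 0) (q j) := by
        intro r j h1 h2
        rw [had.symm, had.symm (q 0)]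
        exact tail_dist had hn hqs hq0 (dvd_mul_right n r) h1 h2
      have hd1 := hd 1
      have hd2 := hd 2
      rw [mul_one] at hd1
      rw [mul_comm n 2] at hd2
      refine ⟨δ, had, hd1 _ le_rfl (by omega), fun P hP Q hQ => ?_⟩
      obtain ⟨j, h1, h2, rfl⟩ := hmem P hP Q hQ
      have e1 := hd1 j (by omega) h2
      have e2 := hd2 j (by omega) h2
      exact ⟨e1.symm, e2.trans e1.symm⟩
  rw [hZ, Finset.card_image_of_injOn hinj, Nat.card_Icc] at hcard
  omega

end Tails

/-! ### Fixed points and fibres. -/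

section Counting

theorem ncard_preimage_le {X Y : Type*} {F : X → Y} {b : ℕ}
    (hF : ∀ y, {x | F x = y}.Finite ∧ {x | F x = y}.ncard ≤ b) {s : Set Y} (hs : s.Finite) :
    (F ⁻¹' s).Finite ∧ (F ⁻¹' s).ncard ≤ b * s.ncard := by
  classical
  have hfin : (F ⁻¹' s).Finite := hs.preimage' fun y _ => (hF y).1
  refine ⟨hfin, ?_⟩
  rw [Set.ncard_eq_toFinset_card _ hfin, Set.ncard_eq_toFinset_card _ hs]
  refine Finset.card_le_mul_card_image_of_maps_to (f := F) ?_ b ?_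
  · intro x hx
    simpa using hx
  · intro y _
    rw [← Set.ncard_coe_finset]
    refine (Set.ncard_le_ncard ?_ (hF y).1).trans (hF y).2
    intro x hx
    exact (Finset.mem_filter.1 hx).2

theorem ncard_preimage_iterate_le {X : Type*} {F : X → X} {b : ℕ}
    (hF : ∀ y, {x | F x = y}.Finite ∧ {x | F x = y}.ncard ≤ b) {s : Set X} (hs : s.Finite)
    (m : ℕ) : (F^[m] ⁻¹' s).Finite ∧ (F^[m] ⁻¹' s).ncard ≤ b ^ m * s.ncard := by
  induction m with
  | zero => simpa using hs
  | succ m ih =>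
    rw [Function.iterate_succ, Set.preimage_comp]
    obtain ⟨h1, h2⟩ := ncard_preimage_le hF ih.1
    refine ⟨h1, h2.trans ?_⟩
    rw [pow_succ', mul_assoc]
    exact Nat.mul_le_mul_left b ih.2

variable {K : Type*} [Field K]

/-- The iterate and the identity have degrees `d ^ n` and `1` and differ, since `φ` has infinite
order. -/
theorem ncard_fixedPoints_le {φ : RatFunc K} (hφ : ¬ HasFiniteOrder φ) {n : ℕ} (hn : 0 < n) :
    {Q | (toMap φ)^[n] Q = Q}.Finite ∧
      {Q | (toMap φ)^[n] Q = Q}.ncard ≤ mapDegree φ ^ n + 2 := by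
  obtain ⟨f, g, h⟩ := (IsRep.toMap φ).iterate n
  exact h.finite_eqLocus IsRep.id fun h' => hφ ⟨n, hn, h'⟩

variable [Infinite K]

theorem toMap_ne_const {φ : RatFunc K} (hφ : 1 ≤ mapDegree φ) (P : OnePoint K) :
    toMap φ ≠ fun _ => P := by
  classical
  intro h
  induction P using OnePoint.rec with
  | infty =>
    refine φ.denom_ne_zero (Polynomial.funext fun x => ?_)
    have hx := congrFun h (x : OnePoint K)
    simp only [toMap, OnePoint.elim_some] at hx
    split_ifs at hx with h0
    · simpa using h0
    · exact absurd hx (OnePoint.coe_ne_infty _)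
  | coe c =>
    have : φ = RatFunc.C c := by
      apply toMap_injective
      rw [h]
      funext P
      induction P using OnePoint.rec <;> simp [toMap, mapDegree]
    rw [this] at hφ
    simp [mapDegree] at hφ

theorem ncard_fibre_le {φ : RatFunc K} (hφ : 1 ≤ mapDegree φ) (P : OnePoint K) :
    {Q | toMap φ Q = P}.Finite ∧ {Q | toMap φ Q = P}.ncard ≤ mapDegree φ + 1 := by
  simpa using (IsRep.toMap φ).finite_eqLocus (IsRep.const P) (toMap_ne_const hφ P)

end Counting

/-! ### Assembling the bounds. -/

section Main

/-- A bound for the periods of periodic points, for maps of degree `d` with `s` bad places. -/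
def periodBound (d s : ℕ) : ℕ := Nat.factorial 15 + 4 * equidistantBound d s

/-- A bound for the length of the preperiod, for maps of degree `d` with `s` bad places. -/
def preperiodBound (d s : ℕ) : ℕ := 4 * periodBound d s + equidistantBound d s

/-- A bound for the number of preperiodic points, for maps of degree `d` with `s` bad places. -/
def prePerBound (d s : ℕ) : ℕ :=
  (d + 1) ^ preperiodBound d s * (d ^ (periodBound d s).factorial + 2)

theorem equidistantBound_mono (d : ℕ) {t s : ℕ} (h : t ≤ s) :
    equidistantBound d t ≤ equidistantBound d s := by
  have h1 : (18 * t + 1) ^ 4 ≤ (18 * s + 1) ^ 4 := Nat.pow_le_pow_left (by omega) 4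
  have h2 : ((18 * t + 1) ^ 4) ^ t ≤ ((18 * s + 1) ^ 4) ^ s :=
    (Nat.pow_le_pow_left h1 t).trans (Nat.pow_le_pow_right (by positivity) h)
  simp only [equidistantBound, unitBound]
  omega

variable {k : Type*} [Field k] [IsAlgClosed k] [CharZero k]

/-- All periods up to the bound divide its factorial, and all preperiods are at most
`preperiodBound`, so one iterate and one period serve every point. -/
theorem prePer_subset {T : Finset k} {s : ℕ} (hT : T.card ≤ s) {φ : RatFunc (RatFunc k)}
    (hiso : ¬ IsIsotrivialOver φ)
    (hgood : ∀ α, α ∉ T →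
      ∃ δ, IsAdapted ((linearPrime α).valuation (RatFunc k)) (toMap φ) δ) :
    prePer φ ⊆ (toMap φ)^[preperiodBound (mapDegree φ) s] ⁻¹'
      {Q | (toMap φ)^[(periodBound (mapDegree φ) s).factorial] Q = Q} := by
  classical
  intro P hP
  set F := toMap φ with hF
  have hmono := equidistantBound_mono (mapDegree φ) hT
  have hex : ∃ m, F^[m] P ∈ Function.periodicPts F := by
    obtain ⟨n, m, hn, h⟩ := hP
    refine ⟨m, n, hn, ?_⟩
    rwa [Function.iterate_add_apply] at h
  set m := Nat.find hex
  have hm : F^[m] P ∈ Function.periodicPts F := Nat.find_spec hex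
  have hmin : ∀ l < m, F^[l] P ∉ Function.periodicPts F := fun l hl => Nat.find_min hex hl
  set n := Function.minimalPeriod F (F^[m] P)
  have hn0 : 0 < n := Function.minimalPeriod_pos_of_mem_periodicPts hm
  have hper : Function.IsPeriodicPt F n (F^[m] P) := Function.isPeriodicPt_minimalPeriod _ _
  have hn : n ≤ periodBound (mapDegree φ) s := by
    have := minimalPeriod_le hiso hgood (F^[m] P)
    rw [periodBound]
    exact this.trans (by omega)
  have hmle : m ≤ preperiodBound (mapDegree φ) s := by
    have := tail_length_le hiso hgood hn0 hper hmin
    rw [preperiodBound]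
    omega
  have h1 : Function.IsPeriodicPt F (periodBound (mapDegree φ) s).factorial (F^[m] P) :=
    hper.trans_dvd (Nat.dvd_factorial hn0 hn)
  have h2 := h1.apply_iterate (preperiodBound (mapDegree φ) s - m)
  rw [← Function.iterate_add_apply, Nat.sub_add_cancel hmle] at h2
  exact h2

end Main

end ProjLineDyn
end

theorem theorem1p1 :
    ∃ B : ℕ → ℕ → ℕ,
      ∀ (k : Type*) [Field k] [IsAlgClosed k] [CharZero k]
        (S : Finset (OnePoint k)) (d : ℕ),
        1 ≤ S.card → 1 ≤ d →
        ∀ φ : RatFunc (RatFunc k),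
          ProjLineDyn.mapDegree φ = d →
          ¬ ProjLineDyn.IsIsotrivialOver φ →
          ¬ ProjLineDyn.HasFiniteOrder φ →
          (∀ p : OnePoint k, p ∉ S → ProjLineDyn.HasGoodReduction p φ) →
          (ProjLineDyn.prePer φ).Finite ∧ (ProjLineDyn.prePer φ).ncard ≤ B d S.card := by
  refine ⟨ProjLineDyn.prePerBound, ?_⟩
  intro k _ _ _ S d _ hd φ hφ hiso hord hgood
  classical
  subst hφ
  -- Only the finite places of `S` are kept: Mason's theorem for polynomials imposes no condition at
  -- `∞`, and the bounds increase with `#T`.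
  set T : Finset k := S.preimage (fun α : k => (α : OnePoint k))
    OnePoint.coe_injective.injOn with hT
  have hTS : T.card ≤ S.card :=
    Finset.card_le_card_of_injOn (fun α : k => (α : OnePoint k))
      (fun α hα => Finset.mem_preimage.1 hα) OnePoint.coe_injective.injOn
  have hsub := ProjLineDyn.prePer_subset hTS hiso fun α hα =>
    (hgood (α : OnePoint k) fun h => hα (Finset.mem_preimage.2 h)).exists_isAdapted
  have hinf : Infinite (RatFunc k) :=
    Infinite.of_injective _ (algebraMap k (RatFunc k)).injective
  obtain ⟨h1, h2⟩ := ProjLineDyn.ncard_fixedPoints_le hord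
    (Nat.factorial_pos (ProjLineDyn.periodBound (ProjLineDyn.mapDegree φ) S.card))
  obtain ⟨h3, h4⟩ := ProjLineDyn.ncard_preimage_iterate_le (ProjLineDyn.ncard_fibre_le hd) h1
    (ProjLineDyn.preperiodBound (ProjLineDyn.mapDegree φ) S.card)
  refine ⟨h3.subset hsub, (Set.ncard_le_ncard hsub h3).trans (h4.trans ?_)⟩
  exact Nat.mul_le_mul_left _ h2
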